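/- Let $M(1)$ be the rank one free bosonic (Heisenberg) vertex operator algebra over $\mathbb{C}$: with $\mathfrak h=\mathbb{C}h$, $\langle h,h\rangle=1$, and for $\mu\in\mathbb{C}$, let $M(1,\mu)=S(\mathfrak h\otimes t^{-1}\mathbb{C}[t^{-1}])\otimes \mathbb{C}e^{\mu}$ be the Fock space on which the operators $h(n)$ ($n\in\mathbb{Z}$) satisfy $[h(m),h(n)]=m\delta_{m+n,0}$, $h(0)$ acts as $\mu$, $h(n)e^{\mu}=0$ for $n>0$, and $h(-n)$ ($n>0$) acts by multiplication; put $h(z)=\sum_{n\in\mathbb{Z}}h(n)z^{-n-1}$ and $\partial^{(n)}=\frac{1}{n!}\left(\frac{d}{dz}\right)^{n}$. Then $M(1)=M(1,0)$, with vacuum $\mathbf 1=e^{0}$ and conformal vector $\omega=\frac12 h(-1)^2\mathbf 1$, acts on $M(1,\mu)$ by $$Y\bigl(h(-n_1)\cdots h(-n_k)\mathbf 1,z\bigr)={:}\,\partial^{(n_1-1)}h(z)\cdots\partial^{(n_k-1)}h(z)\,{:}\qquad(n_1,\dots,n_k\ge 1).$$ Let $\theta$ be the automorphism of $M(1)$ with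 $\theta\bigl(h(-n_1)\cdots h(-n_k)\mathbf 1\bigr)=(-1)^k h(-n_1)\cdots h(-n_k)\mathbf 1$, let $M(1)^{\pm}$ be its $\pm1$-eigenspaces, and regard $M(1)^{\pm}$ and $M(1,\mu)$ as modules over the vertex operator algebra $M(1)^+$. For $M(1)^+$-modules $M^1,M^2,M^3$ let $N_{M^1M^2}^{M^3}$ denote the fusion rule, that is, the dimension of the space of intertwining operators $I(\cdot,z)=\sum_{n\in\mathbb{C}}(\cdot)_n z^{-n-1}$ from $M^1$ to $\mathrm{Hom}(M^2,M^3)\{z\}$ (linear maps satisfying the truncation condition, the Jacobi identity and $\frac{d}{dz}I(v,z)=I(L(-1)v,z)$). Then for all $\mu,\nu\in\mathbb{C}$ with $\mu^2=\nu^2$, both fusion rules $$N_{M(1)^{+}\,M(1,\mu)}^{M(1,\nu)}\quad\text{and}\quad N_{M(1)^{-}\,M(1,\mu)}^{M(1,\nu)}$$ are nonzero. Furthermore, the four fusion rules $$N_{M(1)^{+}\,M(1)^{+}}^{M(1)^{+}},\qquad N_{M(1)^{+}\,M(1)^{-}}^{M(1)^{-}},\qquad N_{M(1)^{-}\,M(1)^{+}}^{M(1)^{-}},\qquad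 N_{M(1)^{-}\,M(1)^{-}}^{M(1)^{+}}$$ are nonzero. -/

import Mathlib

noncomputable section

namespace FreeBoson

open MvPolynomial

/-! ### Vertex operators

A Mathlib `VertexOperator ℂ M` is a linear map `A(z) : M → M((z))`; its modes are
`A(z) = ∑ₙ Aₙ z^(-n-1)`, where `Aₙ` is `VertexOperator.ncoeff A n`. -/

section VertexOperators

variable {M : Type*} [AddCommGroup M] [Module ℂ M]

theorem ncoeff_injective {A B : VertexOperator ℂ M}
    (h : ∀ n : ℤ, VertexOperator.ncoeff A n = VertexOperator.ncoeff B n) : A = B := by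
  apply HVertexOperator.coeff_inj
  funext n
  rw [VertexOperator.coeff_eq_ncoeff, VertexOperator.coeff_eq_ncoeff, h]

theorem ncoeff_truncated (A : VertexOperator ℂ M) (u : M) :
    ∃ N : ℤ, ∀ n : ℤ, N ≤ n → VertexOperator.ncoeff A n u = 0 :=
  ⟨-((HahnModule.of ℂ).symm (A u)).order, fun n hn =>
    VertexOperator.ncoeff_eq_zero_of_lt_order A n u (by omega)⟩

/-- The vertex operator `∑ₙ fₙ z^(-n-1)` with given modes `fₙ`, where every vector is killed by
`fₙ` for all sufficiently large `n`. -/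
def ofModes (f : ℤ → Module.End ℂ M)
    (hf : ∀ u : M, ∃ N : ℤ, ∀ n : ℤ, N ≤ n → f n u = 0) : VertexOperator ℂ M :=
  VertexOperator.of_coeff (fun n => f (-n - 1)) (by
    intro u
    obtain ⟨N, hN⟩ := hf u
    refine ⟨-N, fun n hn => ?_⟩
    by_contra hlt
    exact hn (hN _ (by omega)))

@[simp]
theorem ncoeff_ofModes (f : ℤ → Module.End ℂ M)
    (hf : ∀ u : M, ∃ N : ℤ, ∀ n : ℤ, N ≤ n → f n u = 0) (n : ℤ) :
    VertexOperator.ncoeff (ofModes f hf) n = f n := by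
  rw [ofModes, VertexOperator.ncoeff_of_coeff]
  congr 1
  ring

/-- The identity field: its only nonzero mode is the one of index `-1`. -/
def idField (M : Type*) [AddCommGroup M] [Module ℂ M] : VertexOperator ℂ M :=
  ofModes (fun n => if n = -1 then 1 else 0) (fun u => ⟨0, fun n hn => by
    rw [if_neg (by omega)]; rfl⟩)

/-- The divided derivative `∂^(r) A(z) = (1/r!) (d/dz)^r A(z)`: the term `Aₙ z^(-n-1)` becomes
`(-n-1 choose r) Aₙ z^(-n-1-r)`. -/
def dividedDeriv (r : ℕ) (A : VertexOperator ℂ M) : VertexOperator ℂ M :=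
  ofModes (fun p => (Ring.choose ((r : ℤ) - p - 1) r : ℤ) • VertexOperator.ncoeff A (p - r))
    (fun u => by
      obtain ⟨N, hN⟩ := ncoeff_truncated A u
      refine ⟨N + r, fun n hn => ?_⟩
      rw [LinearMap.smul_apply, hN _ (by omega), smul_zero])

/-- The `j`-th summand of the `k`-th mode of a normally ordered product. -/
def normalOrderTerm (A B : VertexOperator ℂ M) (k : ℤ) (j : ℕ) : Module.End ℂ M :=
  VertexOperator.ncoeff A (-(j : ℤ) - 1) * VertexOperator.ncoeff B (k + j) +
    VertexOperator.ncoeff B (k - j - 1) * VertexOperator.ncoeff A (j : ℤ)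

theorem normalOrderTerm_finite (A B : VertexOperator ℂ M) (k : ℤ) (u : M) :
    (Function.support fun j : ℕ => normalOrderTerm A B k j u).Finite := by
  obtain ⟨N, hN⟩ := ncoeff_truncated A u
  obtain ⟨N', hN'⟩ := ncoeff_truncated B u
  refine (Set.finite_Iio (max N.toNat (N' - k).toNat)).subset fun j hj => ?_
  by_contra hlt
  simp only [Set.mem_Iio, not_lt, max_le_iff, Int.toNat_le] at hlt
  apply hj
  simp [normalOrderTerm, hN j hlt.1, hN' (k + j) (by omega)]

/-- The normally ordered product `:A(z)B(z): = A(z)⁻ B(z) + B(z) A(z)⁺`, where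
`A(z)⁻ = ∑_{n<0} Aₙ z^(-n-1)` and `A(z)⁺ = ∑_{n≥0} Aₙ z^(-n-1)`. -/
def normalOrder (A B : VertexOperator ℂ M) : VertexOperator ℂ M :=
  ofModes
    (fun k =>
      { toFun := fun u => ∑ᶠ j : ℕ, normalOrderTerm A B k j u
        map_add' := fun u v => by
          simp only [map_add]
          exact finsum_add_distrib (normalOrderTerm_finite A B k u)
            (normalOrderTerm_finite A B k v)
        map_smul' := fun c u => by
          simp only [map_smul, RingHom.id_apply]
          exact (smul_finsum' c (normalOrderTerm_finite A B k u)).symm })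
    (fun u => by
      obtain ⟨N, hN⟩ := ncoeff_truncated A u
      obtain ⟨N', hN'⟩ := ncoeff_truncated B u
      choose T hT using fun j : ℕ => ncoeff_truncated B (VertexOperator.ncoeff A (j : ℤ) u)
      obtain ⟨S, hS⟩ := ((Finset.range N.toNat).image T).bddAbove
      refine ⟨max N' (S + N.toNat + 1), fun k hk => ?_⟩
      rw [max_le_iff] at hk
      change ∑ᶠ j : ℕ, normalOrderTerm A B k j u = 0
      refine finsum_eq_zero_of_forall_eq_zero fun j => ?_
      have h1 : VertexOperator.ncoeff B (k + j) u = 0 := hN' _ (by omega)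
      have h2 : VertexOperator.ncoeff B (k - j - 1) (VertexOperator.ncoeff A (j : ℤ) u) = 0 := by
        by_cases hj : j < N.toNat
        · have := hS (Finset.mem_coe.2 (Finset.mem_image_of_mem T (Finset.mem_range.2 hj)))
          exact hT j _ (by omega)
        · rw [hN j (by omega), map_zero]
      simp [normalOrderTerm, h1, h2])

theorem ncoeff_normalOrder (A B : VertexOperator ℂ M) (k : ℤ) (u : M) :
    VertexOperator.ncoeff (normalOrder A B) k u = ∑ᶠ j : ℕ, normalOrderTerm A B k j u := by
  rw [normalOrder, ncoeff_ofModes]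
  rfl

/-- Restriction of a vertex operator to a subspace that is stable under all its modes. -/
def restrictField (W : Submodule ℂ M) (A : VertexOperator ℂ M)
    (hA : ∀ n : ℤ, ∀ u ∈ W, VertexOperator.ncoeff A n u ∈ W) : VertexOperator ℂ W :=
  ofModes (fun n => (VertexOperator.ncoeff A n).restrict (hA n)) (fun u => by
    obtain ⟨N, hN⟩ := ncoeff_truncated A (u : M)
    exact ⟨N, fun n hn => Subtype.ext (hN n hn)⟩)

end VertexOperators

/-! ### Intertwining operators and fusion rules -/

section Intertwining

variable {V M₁ M₂ M₃ : Type*} [AddCommGroup V] [Module ℂ V] [AddCommGroup M₁] [Module ℂ M₁]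
  [AddCommGroup M₂] [Module ℂ M₂] [AddCommGroup M₃] [Module ℂ M₃]

/-- A linear map `I : M₁ → Hom(M₂, M₃){z}`, `v ↦ I(v, z) = ∑_{n ∈ ℂ} vₙ z^(-n-1)` with
`vₙ = I v n`, is an intertwining operator for the weak modules `(Mᵢ, Yᵢ)` over a vertex operator
algebra `V` with conformal vector `ω`. -/
structure IsIntertwining (ω : V) (Y₁ : V →ₗ[ℂ] VertexOperator ℂ M₁)
    (Y₂ : V →ₗ[ℂ] VertexOperator ℂ M₂) (Y₃ : V →ₗ[ℂ] VertexOperator ℂ M₃)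
    (I : M₁ →ₗ[ℂ] ℂ → (M₂ →ₗ[ℂ] M₃)) : Prop where
  /-- For fixed `n`, `v_{n+k} u = 0` for all sufficiently large integers `k`. -/
  truncation : ∀ (v : M₁) (u : M₂) (n : ℂ), ∃ K : ℤ, ∀ k : ℤ, K ≤ k → I v (n + k) u = 0
  /-- The Jacobi identity: equality of the coefficients of `z₀^(-l-1) z₁^(-m-1) z₂^(-n-1)` in
  `z₀⁻¹ δ((z₁-z₂)/z₀) Y₃(a,z₁) I(v,z₂) u - z₀⁻¹ δ((z₂-z₁)/(-z₀)) I(v,z₂) Y₂(a,z₁) u` and in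
  `z₂⁻¹ δ((z₁-z₀)/z₂) I(Y₁(a,z₀)v,z₂) u`. All three sums are finite. -/
  jacobi : ∀ (a : V) (v : M₁) (u : M₂) (l m : ℤ) (n : ℂ),
    (∑ᶠ i : ℕ, ((-1 : ℂ) ^ i * (Ring.choose l i : ℤ)) •
        VertexOperator.ncoeff (Y₃ a) (m + l - i) (I v (n + i) u)) -
      (∑ᶠ i : ℕ, ((-1 : ℂ) ^ l * (-1 : ℂ) ^ i * (Ring.choose l i : ℤ)) •
        I v (n + l - i) (VertexOperator.ncoeff (Y₂ a) (m + i) u)) =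
      ∑ᶠ i : ℕ, ((Ring.choose m i : ℤ) : ℂ) •
        I (VertexOperator.ncoeff (Y₁ a) (l + i) v) (m + n - i) u
  /-- `(d/dz) I(v,z) = I(L(-1)v,z)`, where `L(-1)` is the mode of `ω` of index `0`. -/
  derivative : ∀ (v : M₁) (n : ℂ),
    I (VertexOperator.ncoeff (Y₁ ω) 0 v) n = (-n) • I v (n - 1)

/-- The vector space of intertwining operators. -/
def intertwiningOperators (ω : V) (Y₁ : V →ₗ[ℂ] VertexOperator ℂ M₁)
    (Y₂ : V →ₗ[ℂ] VertexOperator ℂ M₂) (Y₃ : V →ₗ[ℂ] VertexOperator ℂ M₃) :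
    Submodule ℂ (M₁ →ₗ[ℂ] ℂ → (M₂ →ₗ[ℂ] M₃)) where
  carrier := {I | IsIntertwining ω Y₁ Y₂ Y₃ I}
  zero_mem' :=
    { truncation := fun v u n => ⟨0, fun k _ => by simp⟩
      jacobi := fun a v u l m n => by simp
      derivative := fun v n => by simp }
  add_mem' := by
    intro I J hI hJ
    have trunc : ∀ (v : M₁) (u : M₂) (n : ℂ), ∃ K : ℤ, ∀ k : ℤ, K ≤ k →
        I v (n + k) u = 0 ∧ J v (n + k) u = 0 := fun v u n => by
      obtain ⟨K, hK⟩ := hI.truncation v u n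
      obtain ⟨K', hK'⟩ := hJ.truncation v u n
      exact ⟨max K K', fun k hk => ⟨hK k (le_trans (le_max_left _ _) hk),
        hK' k (le_trans (le_max_right _ _) hk)⟩⟩
    refine ⟨fun v u n => ?_, fun a v u l m n => ?_, fun v n => ?_⟩
    · obtain ⟨K, hK⟩ := trunc v u n
      exact ⟨K, fun k hk => by simp [hK k hk]⟩
    · have key : ∀ {f g : ℕ → M₃}, (∃ N : ℕ, ∀ i, N ≤ i → f i = 0 ∧ g i = 0) →
          ∑ᶠ i, (f i + g i) = ∑ᶠ i, f i + ∑ᶠ i, g i := by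
        rintro f g ⟨N, hN⟩
        have fin : ∀ {h : ℕ → M₃}, (∀ i, N ≤ i → h i = 0) → (Function.support h).Finite :=
          fun hh => (Set.finite_Iio N).subset fun i hi => by
            by_contra hlt
            exact hi (hh i (not_lt.1 hlt))
        exact finsum_add_distrib (fin fun i hi => (hN i hi).1) (fin fun i hi => (hN i hi).2)
      have e1 := hI.jacobi a v u l m n
      have e2 := hJ.jacobi a v u l m n
      simp only [LinearMap.add_apply, Pi.add_apply, map_add, smul_add]
      rw [key, key, key, ← e1, ← e2]
      · abel
      · obtain ⟨N, hN⟩ := ncoeff_truncated (Y₁ a) v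
        refine ⟨(N - l).toNat, fun i hi => ?_⟩
        rw [hN _ (by omega)]
        simp
      · obtain ⟨N, hN⟩ := ncoeff_truncated (Y₂ a) u
        refine ⟨(N - m).toNat, fun i hi => ?_⟩
        rw [hN _ (by omega)]
        simp
      · obtain ⟨K, hK⟩ := trunc v u n
        refine ⟨K.toNat, fun i hi => ?_⟩
        have := hK i (by omega)
        rw [Int.cast_natCast] at this
        simp [this.1, this.2]
    · simp [hI.derivative, hJ.derivative]
  smul_mem' := by
    intro c I hI
    refine ⟨fun v u n => ?_, fun a v u l m n => ?_, fun v n => ?_⟩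
    · obtain ⟨K, hK⟩ := hI.truncation v u n
      exact ⟨K, fun k hk => by simp [hK k hk]⟩
    · have e := hI.jacobi a v u l m n
      simp only [LinearMap.smul_apply, Pi.smul_apply, map_smul, smul_comm _ c]
      rw [← smul_finsum, ← smul_finsum, ← smul_finsum, ← e, smul_sub]
    · simp [hI.derivative, smul_comm c]

/-- The fusion rule: the dimension of the space of intertwining operators. -/
def fusionRule (ω : V) (Y₁ : V →ₗ[ℂ] VertexOperator ℂ M₁)
    (Y₂ : V →ₗ[ℂ] VertexOperator ℂ M₂) (Y₃ : V →ₗ[ℂ] VertexOperator ℂ M₃) : Cardinal :=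
  Module.rank ℂ (intertwiningOperators ω Y₁ Y₂ Y₃)

end Intertwining

/-! ### The Fock spaces `M(1,μ)` of rank one -/

/-- The underlying space `S(𝔥 ⊗ t⁻¹ℂ[t⁻¹])`, `𝔥 = ℂh` with `⟨h,h⟩ = 1`: the polynomial algebra in
`h(-1), h(-2), …`, where `X k` stands for `h(-(k+1))`. It carries all the `M(1,μ)`, with
`u ⊗ e^μ` written as `u`. -/
abbrev Fock : Type := MvPolynomial ℕ ℂ

/-- The action of `h(n) = h ⊗ tⁿ` on `M(1,μ)`: `h(-(k+1))` is multiplication by `X k`, `h(0)` is the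
scalar `μ`, and `h(k+1)` is `(k+1) ∂/∂(X k)`. -/
def heisenbergMode (μ : ℂ) : ℤ → Module.End ℂ Fock
  | Int.negSucc k => LinearMap.mulLeft ℂ (X k : Fock)
  | Int.ofNat 0 => μ • LinearMap.id
  | Int.ofNat (k + 1) => ((k : ℂ) + 1) • ((pderiv k : Derivation ℂ Fock Fock) : Fock →ₗ[ℂ] Fock)

theorem heisenbergMode_neg (μ : ℂ) (k : ℕ) (u : Fock) :
    heisenbergMode μ (Int.negSucc k) u = X k * u := by
  simp [heisenbergMode]

theorem heisenbergMode_zero (μ : ℂ) (u : Fock) :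
    heisenbergMode μ (Int.ofNat 0) u = μ • u := by
  simp [heisenbergMode]

theorem heisenbergMode_pos (μ : ℂ) (k : ℕ) (u : Fock) :
    heisenbergMode μ (Int.ofNat (k + 1)) u = ((k : ℂ) + 1) • pderiv k u := by
  simp [heisenbergMode]

/-- The field `h(z) = ∑ₙ h(n) z^(-n-1)` on `M(1,μ)`. -/
def heisenbergField (μ : ℂ) : VertexOperator ℂ Fock :=
  ofModes (heisenbergMode μ) (fun u => by
    obtain ⟨N, hN⟩ := u.vars.bddAbove
    refine ⟨N + 2, fun n hn => ?_⟩
    obtain ⟨k, rfl⟩ : ∃ k : ℕ, n = Int.ofNat (k + 1) :=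
      ⟨(n - 1).toNat, by simp only [Int.ofNat_eq_natCast]; omega⟩
    have hk : k ∉ u.vars := fun h => by
      have := hN (Finset.mem_coe.2 h)
      simp only [Int.ofNat_eq_natCast] at hn
      omega
    rw [heisenbergMode_pos, pderiv_eq_zero_of_notMem_vars hk, smul_zero])

/-- The normally ordered product `:∂^(k₁)h(z) ∂^(k₂)h(z) ⋯ ∂^(k_r)h(z):` on `M(1,μ)`. -/
def currentProduct (μ : ℂ) : List ℕ → VertexOperator ℂ Fock
  | [] => idField Fock
  | k :: l => normalOrder (dividedDeriv k (heisenbergField μ)) (currentProduct μ l)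

/-- The vertex operator map `Y(·,z)` of `M(1)` on `M(1,μ)`: the linear map that sends the monomial
`h(-k₁-1) ⋯ h(-k_r-1) 𝟏` to `:∂^(k₁)h(z) ⋯ ∂^(k_r)h(z):`. For `μ = 0` it is the vertex operator map
of the vertex operator algebra `M(1) = M(1,0)`. -/
def fockY (μ : ℂ) : Fock →ₗ[ℂ] VertexOperator ℂ Fock :=
  (basisMonomials ℕ ℂ).constr ℂ fun s =>
    currentProduct μ ((Finsupp.toMultiset s).sort (· ≤ ·))

/-- The conformal vector `ω = (1/2) h(-1)² 𝟏`. -/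
def conformalVector : Fock := C (1 / 2) * X 0 ^ 2

/-- The automorphism `θ` of `M(1)`, given by `h(-n₁) ⋯ h(-n_k) 𝟏 ↦ (-1)^k h(-n₁) ⋯ h(-n_k) 𝟏`. -/
def theta : Fock →ₐ[ℂ] Fock := aeval fun k => -X k

/-! ### The orbifold `M(1)⁺` and its modules `M(1)^±`, `M(1,μ)` -/

/-- `M(1)^ε`, the `ε`-eigenspace of `θ` on `M(1)`, for a sign `ε = ±1`. -/
def orbifold (ε : ℤˣ) : Submodule ℂ Fock :=
  Module.End.eigenspace theta.toLinearMap ((ε : ℤ) : ℂ)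

theorem mem_orbifold {ε : ℤˣ} {u : Fock} : u ∈ orbifold ε ↔ theta u = ((ε : ℤ) : ℂ) • u :=
  Module.End.mem_eigenspace_iff

theorem conformalVector_mem : conformalVector ∈ orbifold 1 := by
  rw [mem_orbifold]
  simp [conformalVector, theta, algHom_C]

theorem theta_pderiv (k : ℕ) (u : Fock) : theta (pderiv k u) = -pderiv k (theta u) := by
  induction u using MvPolynomial.induction_on with
  | C c => simp [theta, algHom_C]
  | add p q hp hq => simp only [map_add, hp, hq, neg_add]
  | mul_X p i hp =>
    have hX : ∀ j, theta (X j) = -X j := fun j => by simp [theta]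
    simp only [Derivation.leibniz, map_add, map_mul, smul_eq_mul, hp, hX, pderiv_X, map_neg,
      Pi.single_apply]
    split_ifs
    · simp
      ring
    · simp

theorem theta_heisenbergMode (μ : ℂ) (n : ℤ) (u : Fock) :
    theta (heisenbergMode μ n u) = -heisenbergMode (-μ) n (theta u) := by
  rcases n with (_ | k) | k
  · rw [heisenbergMode_zero, heisenbergMode_zero, map_smul, neg_smul, neg_neg]
  · rw [heisenbergMode_pos, heisenbergMode_pos, map_smul, theta_pderiv, smul_neg]
  · rw [heisenbergMode_neg, heisenbergMode_neg, map_mul]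
    simp [theta]

theorem theta_dividedDeriv (μ : ℂ) (k : ℕ) (n : ℤ) (u : Fock) :
    theta (VertexOperator.ncoeff (dividedDeriv k (heisenbergField μ)) n u) =
      -VertexOperator.ncoeff (dividedDeriv k (heisenbergField (-μ))) n (theta u) := by
  simp only [dividedDeriv, heisenbergField, ncoeff_ofModes, LinearMap.smul_apply, map_zsmul,
    theta_heisenbergMode, smul_neg]

theorem theta_currentProduct (μ : ℂ) (l : List ℕ) (n : ℤ) (u : Fock) :
    theta (VertexOperator.ncoeff (currentProduct μ l) n u) =
      (-1 : ℂ) ^ l.length • VertexOperator.ncoeff (currentProduct (-μ) l) n (theta u) := by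
  induction l generalizing n u with
  | nil =>
    simp only [currentProduct, idField, ncoeff_ofModes, List.length_nil, pow_zero, one_smul]
    split_ifs <;> simp
  | cons k l ih =>
    simp only [currentProduct, ncoeff_normalOrder]
    rw [map_finsum theta (normalOrderTerm_finite _ _ n u), smul_finsum]
    refine finsum_congr fun j => ?_
    simp only [normalOrderTerm,
      LinearMap.add_apply, Module.End.mul_apply, map_add, ih, theta_dividedDeriv, map_smul,
      map_neg, List.length_cons, pow_succ, smul_add, smul_neg, mul_neg, mul_one, neg_smul]

theorem theta_fockY (μ : ℂ) (a u : Fock) (n : ℤ) :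
    theta (VertexOperator.ncoeff (fockY μ a) n u) =
      VertexOperator.ncoeff (fockY (-μ) (theta a)) n (theta u) := by
  induction a using MvPolynomial.induction_on' with
  | monomial s c =>
    have hY : ∀ (ν : ℂ), fockY ν (monomial s c) =
        c • currentProduct ν ((Finsupp.toMultiset s).sort (· ≤ ·)) := fun ν => by
      have h1 : (monomial s c : Fock) = c • basisMonomials ℕ ℂ s := by
        simp [smul_monomial]
      rw [h1, map_smul, fockY, Module.Basis.constr_basis]
    have hθ : theta (monomial s c) =
        (-1 : ℂ) ^ (Finsupp.toMultiset s).card • (monomial s c : Fock) := by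
      rw [theta, aeval_monomial, Finsupp.card_toMultiset, monomial_eq]
      simp only [neg_pow (X _ : Fock), Finsupp.prod, Finsupp.sum, Finset.prod_mul_distrib,
        Finset.prod_pow_eq_pow_sum, smul_eq_C_mul, algebraMap_eq, map_pow, map_neg, map_one, id]
      ring
    rw [hθ, map_smul, hY, hY]
    simp only [map_smul, Pi.smul_apply, LinearMap.smul_apply, theta_currentProduct,
      Multiset.length_sort]
    rw [smul_comm]
  | add p q hp hq => simp only [map_add, Pi.add_apply, LinearMap.add_apply, hp, hq]

theorem fockY_mem_orbifold {ε : ℤˣ} {a u : Fock} (ha : a ∈ orbifold 1) (hu : u ∈ orbifold ε)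
    (n : ℤ) : VertexOperator.ncoeff (fockY 0 a) n u ∈ orbifold ε := by
  rw [mem_orbifold] at *
  rw [theta_fockY, ha, hu]
  simp

/-- The conformal vector of `M(1)⁺`. -/
def orbifoldOmega : orbifold 1 := ⟨conformalVector, conformalVector_mem⟩

/-- The `M(1)⁺`-module `M(1,μ)`. -/
def fockModule (μ : ℂ) : orbifold 1 →ₗ[ℂ] VertexOperator ℂ Fock :=
  fockY μ ∘ₗ (orbifold 1).subtype

/-- The `M(1)⁺`-module `M(1)^ε`. For `ε = 1` this is the vertex operator map of `M(1)⁺` itself. -/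
def orbifoldModule (ε : ℤˣ) : orbifold 1 →ₗ[ℂ] VertexOperator ℂ (orbifold ε) where
  toFun a := restrictField (orbifold ε) (fockY 0 a) fun n _ hu => fockY_mem_orbifold a.2 hu n
  map_add' a b := by
    apply ncoeff_injective
    intro n
    ext u : 2
    simp [restrictField]
  map_smul' c a := by
    apply ncoeff_injective
    intro n
    ext u : 2
    simp [restrictField]

end FreeBoson

end

/-!
The intertwining operators are the vertex operators themselves. For `v ∈ M(1)^±` the series `Y(v,z)`
acting on `M(1,μ)`, respectively on `M(1)^±`, is an intertwining operator as soon as `M(1,μ)` is a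
module for all of `M(1)`, and it is nonzero because `v = 𝟏` and `v = h(-1)𝟏` have the modes
`v₋₁ = 1` and `v₋₁ = h(-1)`, and multiplication by a nonzero polynomial is injective
(`exists_fockMode_neg_one_eq_mul`). If `ν = -μ`, then `θ : M(1,ν) → M(1,μ)` is an isomorphism of
`M(1)⁺`-modules, and one composes with it. All these cases are instances of
`isIntertwining_extendModes`, which transports the structure along embeddings into Fock spaces.

The work is thus the Jacobi identity for `M(1,μ)` over `M(1)`, in components the Borcherds identity
`borcherds_identity` for vectors `a`, `b`, and the `L(-1)`-derivative property
`fockMode_translation`. Both are proved by induction on the monomial `a` (respectively `v`), adding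
one factor `h(p)`, `p < 0`, at a time. The induction rests on two facts about `h(z)`:

* the iterate formula `fockMode_heisenbergMode`, which expresses the modes of `h(p)a` through those
  of `a`; it is the definition of the normally ordered product, once one knows that normally ordered
  products of derivatives of `h(z)` do not depend on the order (`currentProduct_perm`);
* the commutator formula `heisenbergMode_fockMode` for `[h(m), bₙ]`.

The three sums in the Borcherds identity (`prodSum`, `oppSum`, `iterSum`) satisfy the same recursion
when `a` is replaced by `h(p)a`: each becomes the `p`-th product of `h(z)` with the sum for `a`,
minus a combination of the sums for the pairs `a`, `h(t)b` with `t ≥ 0` (`prodSum_current`,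
`oppSum_current`, `iterSum_current`). So the identity for `a` and all `b` implies that for `h(p)a`
and all `b`; no locality argument is needed. The case `a = 𝟏` is the identity `altChoose_delta`
between binomial coefficients.
-/

noncomputable section

namespace FreeBoson

open MvPolynomial
open Finset.HasAntidiagonal (antidiagonal mem_antidiagonal)

/-! ### Finite sums over pairs of natural numbers -/

section Finsum

variable {M : Type*} [AddCommGroup M]

theorem hasFiniteSupport_of_ge {f : ℕ → M} (N : ℕ) (h : ∀ i, N ≤ i → f i = 0) :
    Function.HasFiniteSupport f :=
  (Set.finite_Iio N).subset fun i hi => by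
    by_contra hlt
    exact hi (h i (not_lt.1 hlt))

theorem hasFiniteSupport_uncurry {f : ℕ → ℕ → M} (N : ℕ) (h₁ : ∀ i j, N ≤ i → f i j = 0)
    (h₂ : ∀ i, ∃ K, ∀ j, K ≤ j → f i j = 0) :
    Function.HasFiniteSupport fun x : ℕ × ℕ => f x.1 x.2 := by
  choose K hK using h₂
  obtain ⟨S, hS⟩ := ((Finset.range N).image K).bddAbove
  refine ((Set.finite_Iio N).prod (Set.finite_Iio S)).subset fun x hx => ?_
  have h1 : x.1 < N := by
    by_contra hlt
    exact hx (h₁ _ _ (not_lt.1 hlt))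
  refine ⟨h1, ?_⟩
  by_contra hlt
  have := hS (Finset.mem_coe.2 (Finset.mem_image_of_mem K (Finset.mem_range.2 h1)))
  exact hx (hK _ _ (this.trans (not_lt.1 hlt)))

theorem hasFiniteSupport_uncurry' {f : ℕ → ℕ → M} (N : ℕ) (h₁ : ∀ i j, N ≤ j → f i j = 0)
    (h₂ : ∀ j, ∃ K, ∀ i, K ≤ i → f i j = 0) :
    Function.HasFiniteSupport fun x : ℕ × ℕ => f x.1 x.2 :=
  (hasFiniteSupport_uncurry (f := fun i j => f j i) N (fun i j => h₁ j i) h₂).preimage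
    (Prod.swap_injective.injOn)

theorem finsum_prod_comm {f : ℕ → ℕ → M}
    (hf : Function.HasFiniteSupport fun x : ℕ × ℕ => f x.1 x.2) :
    ∑ᶠ i, ∑ᶠ j, f i j = ∑ᶠ j, ∑ᶠ i, f i j := by
  have h' : Function.HasFiniteSupport fun x : ℕ × ℕ => f x.2 x.1 :=
    Set.Finite.preimage Prod.swap_injective.injOn hf
  rw [← finsum_curry (fun x : ℕ × ℕ => f x.1 x.2) hf,
    ← finsum_curry (fun x : ℕ × ℕ => f x.2 x.1) h']
  exact finsum_eq_of_bijective Prod.swap Prod.swap_bijective fun x => rfl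

theorem finsum_prod_add {f g : ℕ → ℕ → M}
    (hf : Function.HasFiniteSupport fun x : ℕ × ℕ => f x.1 x.2)
    (hg : Function.HasFiniteSupport fun x : ℕ × ℕ => g x.1 x.2) :
    ∑ᶠ i, ∑ᶠ j, (f i j + g i j) = ∑ᶠ i, ∑ᶠ j, f i j + ∑ᶠ i, ∑ᶠ j, g i j := by
  rw [← finsum_curry (fun x : ℕ × ℕ => f x.1 x.2) hf,
    ← finsum_curry (fun x : ℕ × ℕ => g x.1 x.2) hg, ← finsum_add_distrib hf hg,
    ← finsum_curry (fun x : ℕ × ℕ => f x.1 x.2 + g x.1 x.2) (hf.add hg)]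

theorem finsum_prod_sum {ι : Type*} {f : ι → ℕ → ℕ → M} (s : Finset ι)
    (hf : ∀ t ∈ s, Function.HasFiniteSupport fun x : ℕ × ℕ => f t x.1 x.2) :
    Function.HasFiniteSupport (fun x : ℕ × ℕ => ∑ t ∈ s, f t x.1 x.2) ∧
    ∑ᶠ i, ∑ᶠ j, ∑ t ∈ s, f t i j = ∑ t ∈ s, ∑ᶠ i, ∑ᶠ j, f t i j := by
  classical
  induction s using Finset.induction_on with
  | empty => simp [Function.HasFiniteSupport]
  | insert t s ht ih =>
    obtain ⟨ih1, ih2⟩ := ih fun t' h' => hf t' (Finset.mem_insert_of_mem h')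
    have h0 := hf t (Finset.mem_insert_self _ _)
    simp only [Finset.sum_insert ht]
    exact ⟨h0.add ih1, by rw [finsum_prod_add h0 ih1, ih2]⟩

theorem finsum_prod_antidiagonal {f : ℕ → ℕ → M}
    (hf : Function.HasFiniteSupport fun x : ℕ × ℕ => f x.1 x.2) :
    ∑ᶠ i, ∑ᶠ j, f i j = ∑ᶠ s, ∑ x ∈ antidiagonal s, f x.1 x.2 := by
  classical
  have hmem : ∀ x, x ∈ hf.toFinset ↔ f x.1 x.2 ≠ 0 := fun x => Set.Finite.mem_toFinset hf
  rw [← finsum_curry (fun x : ℕ × ℕ => f x.1 x.2) hf]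
  rw [finsum_eq_sum_of_support_subset (s := hf.toFinset) _ (fun x hx => (hmem x).2 hx)]
  have hsub : (Function.support fun s => ∑ x ∈ antidiagonal s, f x.1 x.2) ⊆
      (hf.toFinset.image fun x => x.1 + x.2 : Finset ℕ) := by
    intro s hs
    obtain ⟨x, hx, hne⟩ := Finset.exists_ne_zero_of_sum_ne_zero hs
    rw [Finset.mem_coe, Finset.mem_image]
    exact ⟨x, (hmem x).2 hne, mem_antidiagonal.1 hx⟩
  rw [finsum_eq_sum_of_support_subset _ hsub,
    ← Finset.sum_fiberwise_of_maps_to (t := hf.toFinset.image fun x => x.1 + x.2)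
      (g := fun x : ℕ × ℕ => x.1 + x.2) (fun x hx => Finset.mem_image_of_mem _ hx)]
  refine Finset.sum_congr rfl fun s _ => ?_
  apply Finset.sum_subset_zero_on_sdiff
  · intro x hx
    simpa using (Finset.mem_filter.1 hx).2
  · intro x hx
    simp only [Finset.mem_sdiff, mem_antidiagonal, Finset.mem_filter, hmem, not_and] at hx
    by_contra h
    exact hx.2 h hx.1
  · intros
    rfl

theorem finsum_shift {f : ℕ → M} (t : ℕ) (h : ∀ s, s < t → f s = 0) :
    ∑ᶠ s, f s = ∑ᶠ s, f (s + t) := by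
  have : (Function.support f) ⊆ Set.range fun s => s + t := by
    intro s hs
    have : t ≤ s := by
      by_contra hlt
      exact hs (h s (not_le.1 hlt))
    exact ⟨s - t, by simp; omega⟩
  rw [← finsum_mem_range (add_left_injective t), ← finsum_mem_univ,
    ← finsum_mem_inter_support f Set.univ, ← finsum_mem_inter_support f (Set.range _),
    Set.univ_inter, Set.inter_eq_right.2 this]

theorem finsum_eq_sum_range {f : ℕ → M} (N : ℕ) (h : ∀ i, N ≤ i → f i = 0) :
    ∑ᶠ i, f i = ∑ i ∈ Finset.range N, f i :=
  finsum_eq_sum_of_support_subset _ fun i hi => by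
    by_contra hlt
    exact hi (h i (by simpa using hlt))

end Finsum

/-! ### Binomial coefficients of integers -/

section Binomial

/-- The binomial coefficient `(p choose j)` of an integer `p`, as a complex number. -/
def intChoose (p : ℤ) (j : ℕ) : ℂ := (Ring.choose p j : ℤ)

/-- The signed binomial coefficient `(-1)^j (p choose j)`, the coefficient of `x^(p-j) y^j` in the
expansion of `(x - y)^p` in nonnegative powers of `y`. -/
def altChoose (p : ℤ) (j : ℕ) : ℂ := (-1) ^ j * intChoose p j

@[simp] theorem intChoose_zero (p : ℤ) : intChoose p 0 = 1 := by simp [intChoose]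

@[simp] theorem altChoose_zero (p : ℤ) : altChoose p 0 = 1 := by simp [altChoose]

theorem intChoose_nat (n j : ℕ) : intChoose n j = n.choose j := by
  rw [intChoose, Ring.choose_natCast]; simp

theorem intChoose_neg_succ (k j : ℕ) :
    intChoose (-k - 1) j = (-1) ^ j * ((k + j).choose j : ℂ) := by
  rw [intChoose, show (-k - 1 : ℤ) = -(k + 1 : ℤ) by ring, Ring.choose_neg,
    show (k + 1 + j - 1 : ℤ) = ((k + j : ℕ) : ℤ) by push_cast; ring, Ring.choose_natCast]
  simp [Units.smul_def, Int.negOnePow_def]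

theorem altChoose_neg_succ (k j : ℕ) : altChoose (-k - 1) j = ((k + j).choose j : ℂ) := by
  rw [altChoose, intChoose_neg_succ, ← mul_assoc, ← mul_pow]; simp

theorem sum_intChoose_mul (p q : ℤ) (s : ℕ) :
    ∑ x ∈ antidiagonal s, intChoose p x.1 * intChoose q x.2 = intChoose (p + q) s := by
  simp only [intChoose, Ring.add_choose_eq s (Commute.all p q), Int.cast_sum, Int.cast_mul]

theorem sum_altChoose_mul (p q : ℤ) (s : ℕ) :
    ∑ x ∈ antidiagonal s, altChoose p x.1 * altChoose q x.2 = altChoose (p + q) s := by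
  rw [altChoose, ← sum_intChoose_mul, Finset.mul_sum]
  refine Finset.sum_congr rfl fun x hx => ?_
  rw [← mem_antidiagonal.1 hx, altChoose, altChoose, pow_add]
  ring

/-- Choosing `j + t` out of `p` and `t` out of these, or `t` out of `p` and `j` out of the rest. -/
theorem intChoose_mul_choose (p : ℤ) (j t : ℕ) :
    intChoose p (j + t) * intChoose (j + t : ℕ) t = intChoose p t * intChoose (p - t) j := by
  have := Ring.choose_smul_choose p (Nat.le_add_left t j)
  rw [Nat.add_sub_cancel] at this
  rw [intChoose_nat, intChoose, intChoose, intChoose, ← Int.cast_mul, ← this]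
  simp [mul_comm]

/-- Choosing disjoint sets of sizes `i` and `r` out of `p`, in either order. -/
theorem intChoose_mul_comm (p : ℤ) (i r : ℕ) :
    intChoose p i * intChoose (p - i) r = intChoose p r * intChoose (p - r) i := by
  rw [← intChoose_mul_choose, ← intChoose_mul_choose, add_comm, intChoose_nat, intChoose_nat]
  congr 2
  rw [Nat.choose_symm_add]

/-- The upper entry is a natural number here: `intChoose p t` never vanishes for `p < 0`. -/
theorem intChoose_eq_zero {j t : ℕ} (h : j < t) : intChoose (j : ℤ) t = 0 := by
  rw [intChoose_nat, Nat.choose_eq_zero_of_lt h, Nat.cast_zero]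

theorem succ_mul_intChoose_succ (m : ℤ) (k : ℕ) :
    ((k : ℂ) + 1) * intChoose m (k + 1) = intChoose m k * (m - k) := by
  have := intChoose_mul_choose m 1 k
  rw [add_comm 1 k, intChoose_nat, Nat.choose_succ_self_right] at this
  push_cast at this
  rw [mul_comm, this]
  simp [intChoose]

/-- Two successive expansions in a single combined index: the Chu-Vandermonde identity. -/
theorem finsum_finsum_altChoose {M : Type*} [AddCommGroup M] [Module ℂ M] (p q : ℤ) (G : ℕ → M)
    (N : ℕ) (hG : ∀ i, N ≤ i → G i = 0) :
    ∑ᶠ i : ℕ, ∑ᶠ j : ℕ, (altChoose p i * altChoose q j) • G (i + j) =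
      ∑ᶠ s : ℕ, altChoose (p + q) s • G s := by
  rw [finsum_prod_antidiagonal (f := fun i j => (altChoose p i * altChoose q j) • G (i + j))]
  · refine finsum_congr fun s => ?_
    rw [← sum_altChoose_mul, Finset.sum_smul]
    refine Finset.sum_congr rfl fun x hx => ?_
    rw [mem_antidiagonal.1 hx]
  · exact hasFiniteSupport_uncurry
      (f := fun i j => (altChoose p i * altChoose q j) • G (i + j)) N
      (fun i j h => by simp [hG (i + j) (by omega)])
      fun i => ⟨N, fun j h => by simp [hG (i + j) (by omega)]⟩

end Binomial

/-! ### The Heisenberg algebra and products with the current `h(z)` -/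

section Heisenberg

theorem heisenbergMode_neg_sub (μ : ℂ) (k : ℕ) (u : Fock) :
    heisenbergMode μ (-k - 1) u = X k * u := by
  rw [show (-k - 1 : ℤ) = Int.negSucc k by rw [Int.negSucc_eq]; ring, heisenbergMode_neg]

theorem heisenbergMode_natCast_succ (μ : ℂ) (k : ℕ) (u : Fock) :
    heisenbergMode μ ((k : ℤ) + 1) u = ((k : ℂ) + 1) • pderiv k u :=
  heisenbergMode_pos μ k u

theorem heisenbergMode_zero' (μ : ℂ) (u : Fock) : heisenbergMode μ 0 u = μ • u :=
  heisenbergMode_zero μ u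

theorem int_cases (n : ℤ) : (∃ k : ℕ, n = -k - 1) ∨ n = 0 ∨ ∃ k : ℕ, n = (k : ℤ) + 1 := by
  rcases lt_trichotomy n 0 with h | h | h
  · exact .inl ⟨(-n - 1).toNat, by omega⟩
  · exact .inr (.inl h)
  · exact .inr (.inr ⟨(n - 1).toNat, by omega⟩)

theorem pderiv_comm (k l : ℕ) (u : Fock) : pderiv k (pderiv l u) = pderiv l (pderiv k u) := by
  have h : ⁅pderiv (R := ℂ) k, pderiv (R := ℂ) l⁆ = 0 := by
    refine derivation_ext fun i => ?_
    simp only [Derivation.commutator_apply, pderiv_X, Pi.single_apply]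
    split_ifs <;> simp
  have := congrArg (fun D : Derivation ℂ Fock Fock => D u) h
  simpa [Derivation.commutator_apply, sub_eq_zero] using this

/-- The Heisenberg relation `[h(m), h(n)] = m δ_{m+n,0}` on `M(1,μ)`. -/
theorem heisenbergMode_comm (μ : ℂ) (m n : ℤ) (u : Fock) :
    heisenbergMode μ m (heisenbergMode μ n u) = heisenbergMode μ n (heisenbergMode μ m u) +
      (if m + n = 0 then (m : ℂ) else 0) • u := by
  have key : ∀ (k l : ℕ) (u : Fock), heisenbergMode μ ((k : ℤ) + 1) (heisenbergMode μ (-l - 1) u) =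
      heisenbergMode μ (-l - 1) (heisenbergMode μ ((k : ℤ) + 1) u) +
        (if ((k : ℤ) + 1) + (-l - 1) = 0 then (((k : ℤ) + 1 : ℤ) : ℂ) else 0) • u := by
    intro k l u
    rw [heisenbergMode_neg_sub, heisenbergMode_neg_sub, heisenbergMode_natCast_succ,
      heisenbergMode_natCast_succ, Derivation.leibniz, pderiv_X, smul_add, smul_eq_mul, smul_eq_mul,
      mul_smul_comm]
    congr 1
    by_cases h : k = l
    · subst h
      simp [smul_eq_C_mul, mul_comm]
    · rw [if_neg (by omega), Pi.single_eq_of_ne (Ne.symm h)]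
      simp
  rcases int_cases m with ⟨k, rfl⟩ | rfl | ⟨k, rfl⟩ <;>
    rcases int_cases n with ⟨l, rfl⟩ | rfl | ⟨l, rfl⟩
  · rw [if_neg (by omega)]
    simp only [heisenbergMode_neg_sub]
    simp [mul_left_comm]
  · rw [if_neg (by omega)]
    simp only [heisenbergMode_neg_sub, heisenbergMode_zero']
    simp
  · rw [key, add_assoc, ← add_smul]
    split_ifs with h1 h2 h2
    · rw [← Int.cast_add, h1]
      simp
    · omega
    · omega
    · simp
  · simp only [heisenbergMode_zero', heisenbergMode_neg_sub]
    simp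
  · simp [heisenbergMode_zero']
  · simp only [heisenbergMode_zero', heisenbergMode_natCast_succ]
    rw [Derivation.map_smul, smul_comm, Int.cast_zero, ite_self, zero_smul, add_zero]
  · exact key k l u
  · simp only [heisenbergMode_zero', heisenbergMode_natCast_succ]
    rw [if_neg (by omega), zero_smul, add_zero, Derivation.map_smul, smul_comm]
  · rw [if_neg (by omega)]
    simp only [heisenbergMode_natCast_succ, map_smul]
    rw [pderiv_comm, smul_comm, zero_smul, add_zero]

theorem heisenbergMode_truncated (μ : ℂ) (u : Fock) :
    ∃ N : ℕ, ∀ j : ℕ, N ≤ j → heisenbergMode μ j u = 0 := by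
  obtain ⟨N, hN⟩ := ncoeff_truncated (heisenbergField μ) u
  refine ⟨N.toNat, fun j hj => ?_⟩
  have := hN j (by omega)
  rwa [heisenbergField, ncoeff_ofModes] at this

/-- The modes `∑ⱼ (-1)^j (p choose j) (h(p-j) C_{n+j} - (-1)^p C_{n+p-j} h(j))` of the `p`-th
product of the fields `h(z)` and `C(z)` on `M(1,μ)`. -/
def currentIterate (μ : ℂ) (p : ℤ) (C : ℤ → Module.End ℂ Fock) (n : ℤ) (u : Fock) : Fock :=
  ∑ᶠ j : ℕ, altChoose p j • (heisenbergMode μ (p - j) (C (n + j) u) -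
    (-1 : ℂ) ^ p • C (n + p - j) (heisenbergMode μ j u))

theorem currentIterate_support (μ : ℂ) {C : ℤ → Module.End ℂ Fock}
    (hC : ∀ u, ∃ N : ℤ, ∀ n, N ≤ n → C n u = 0) (n : ℤ) (u : Fock) :
    ∃ N : ℕ, ∀ j : ℕ, N ≤ j → C (n + j) u = 0 ∧ heisenbergMode μ j u = 0 := by
  obtain ⟨N, hN⟩ := hC u
  obtain ⟨K, hK⟩ := heisenbergMode_truncated μ u
  exact ⟨max K (N - n).toNat, fun j hj => ⟨hN _ (by omega), hK j (by omega)⟩⟩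

theorem hasFiniteSupport_currentIterate (μ : ℂ) (p : ℤ) {C : ℤ → Module.End ℂ Fock}
    (hC : ∀ u, ∃ N : ℤ, ∀ n, N ≤ n → C n u = 0) (n : ℤ) (u : Fock) :
    Function.HasFiniteSupport fun j : ℕ =>
      altChoose p j • (heisenbergMode μ (p - j) (C (n + j) u) -
        (-1 : ℂ) ^ p • C (n + p - j) (heisenbergMode μ j u)) := by
  obtain ⟨N, hN⟩ := currentIterate_support μ hC n u
  exact hasFiniteSupport_of_ge N fun j hj => by simp [hN j hj]

/-- The normally ordered product `:∂^(k)h(z) C(z):` is the product of index `-k-1` of `h(z)` and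
`C(z)`. -/
theorem ncoeff_normalOrder_dividedDeriv (μ : ℂ) (k : ℕ) (C : VertexOperator ℂ Fock) (n : ℤ)
    (u : Fock) :
    VertexOperator.ncoeff (normalOrder (dividedDeriv k (heisenbergField μ)) C) n u =
      currentIterate μ (-k - 1) (VertexOperator.ncoeff C) n u := by
  have hA : ∀ q : ℤ, VertexOperator.ncoeff (dividedDeriv k (heisenbergField μ)) q =
      intChoose (k - q - 1) k • heisenbergMode μ (q - k) := by
    intro q
    rw [dividedDeriv, ncoeff_ofModes, heisenbergField, ncoeff_ofModes, intChoose,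
      ← Int.cast_smul_eq_zsmul ℂ]
  obtain ⟨N, hN⟩ := currentIterate_support μ (ncoeff_truncated C) n u
  have h1 : ∀ j : ℕ, intChoose (k - (-j - 1) - 1) k = altChoose (-k - 1) j := by
    intro j
    rw [altChoose_neg_succ, show (k - (-j - 1) - 1 : ℤ) = ((k + j : ℕ) : ℤ) by push_cast; ring,
      intChoose_nat, Nat.choose_symm_add]
  have h2 : ∀ j : ℕ, intChoose (k - (j + k : ℕ) - 1) k =
      -((-1 : ℂ) ^ (-k - 1 : ℤ) * altChoose (-k - 1) j) := by
    intro j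
    rw [altChoose_neg_succ, show (k - (j + k : ℕ) - 1 : ℤ) = -j - 1 by push_cast; ring,
      intChoose_neg_succ, zpow_sub₀ (by norm_num), zpow_neg, zpow_natCast, add_comm j k,
      Nat.choose_symm_add]
    rcases neg_one_pow_eq_or ℂ k with h | h <;> simp [h]
  have h3 : ∀ j : ℕ, j < k → intChoose (k - j - 1) k = 0 := by
    intro j hj
    rw [show (k - j - 1 : ℤ) = ((k - j - 1 : ℕ) : ℤ) by omega, intChoose_eq_zero (by omega)]
  rw [ncoeff_normalOrder, currentIterate]
  simp only [normalOrderTerm, LinearMap.add_apply, Module.End.mul_apply, hA, LinearMap.smul_apply,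
    map_smul, h1, smul_sub, smul_smul]
  rw [finsum_add_distrib, finsum_sub_distrib]
  · refine (congrArg₂ (· + ·) ?_ ?_).trans (sub_eq_add_neg _ _).symm
    · refine finsum_congr fun j => ?_
      rw [show (-j - 1 - k : ℤ) = -k - 1 - j by ring]
    · rw [← finsum_neg_distrib, finsum_shift k]
      · refine finsum_congr fun j => ?_
        rw [h2, neg_smul, mul_comm, show (n - (j + k : ℕ) - 1 : ℤ) = n + (-k - 1) - j by
          push_cast; ring, show ((j + k : ℕ) - k : ℤ) = j by push_cast; ring]
      · intro j hj
        rw [h3 j hj, zero_smul]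
  · exact hasFiniteSupport_of_ge N fun j hj => by simp [(hN j hj).1]
  · exact hasFiniteSupport_of_ge N fun j hj => by simp [(hN j hj).2]
  · exact hasFiniteSupport_of_ge N fun j hj => by simp [(hN j hj).1]
  · refine hasFiniteSupport_of_ge (N + k) fun j hj => ?_
    have := (hN (j - k) (by omega)).2
    rw [Nat.cast_sub (by omega)] at this
    simp [this]

/-- Iterating two negative products with `h(z)` does not depend on the order, because creation
operators commute with each other, and so do annihilation operators. -/
theorem currentIterate_comm (μ : ℂ) {p q : ℤ} (hp : p < 0) (hq : q < 0)
    {C D E : ℤ → Module.End ℂ Fock} (hC : ∀ u, ∃ N : ℤ, ∀ n, N ≤ n → C n u = 0)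
    (hD : ∀ n u, D n u = currentIterate μ q C n u)
    (hE : ∀ n u, E n u = currentIterate μ p C n u) (n : ℤ) (u : Fock) :
    currentIterate μ p D n u = currentIterate μ q E n u := by
  -- `T p q j i` is the `(j, i)`-th summand of the twofold product; it is symmetric under exchange
  -- of `(p, j)` and `(q, i)`.
  let T : ℤ → ℤ → ℕ → ℕ → Fock := fun p q j i =>
    (altChoose p j * altChoose q i) • heisenbergMode μ (p - j) (heisenbergMode μ (q - i)
      (C (n + (j + i)) u)) -
    (altChoose p j * altChoose q i * (-1) ^ q) • heisenbergMode μ (p - j)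
      (C (n + q + j - i) (heisenbergMode μ i u)) -
    (altChoose p j * altChoose q i * (-1) ^ p) • heisenbergMode μ (q - i)
      (C (n + p + i - j) (heisenbergMode μ j u)) +
    (altChoose p j * altChoose q i * (-1) ^ p * (-1) ^ q) • C (n + p + q - j - i)
      (heisenbergMode μ i (heisenbergMode μ j u))
  have expand : ∀ (p q : ℤ) (D : ℤ → Module.End ℂ Fock),
      (∀ n u, D n u = currentIterate μ q C n u) →
      currentIterate μ p D n u = ∑ᶠ j, ∑ᶠ i, T p q j i := by
    intro p q D hD
    refine finsum_congr fun j => ?_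
    have f1 := hasFiniteSupport_currentIterate μ q hC (n + j) u
    have f2 := hasFiniteSupport_currentIterate μ q hC (n + p - j) (heisenbergMode μ j u)
    rw [hD, hD, currentIterate, currentIterate, map_finsum _ f1, smul_finsum,
      ← finsum_sub_distrib (f1.fun_comp (g := heisenbergMode μ (p - j)) (map_zero _))
        (f2.fun_comp (g := fun x => (-1 : ℂ) ^ p • x) (smul_zero _)), smul_finsum]
    refine finsum_congr fun i => ?_
    simp only [T, map_smul, map_sub, smul_sub, smul_smul, show n + ↑j + ↑i = n + (↑j + ↑i) by ring,
      show n + ↑j + q - ↑i = n + q + j - i by ring, show n + p - ↑j + ↑i = n + p + i - j by ring,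
      show n + p - ↑j + q - ↑i = n + p + q - j - i by ring]
    module
  obtain ⟨N, hN⟩ := currentIterate_support μ hC n u
  have fin : ∀ p q, Function.HasFiniteSupport fun x : ℕ × ℕ => T p q x.1 x.2 := by
    intro p q
    refine Function.HasFiniteSupport.add (Function.HasFiniteSupport.sub
      (Function.HasFiniteSupport.sub ?_ ?_) ?_) ?_
    · refine hasFiniteSupport_uncurry (f := fun j i => (altChoose p j * altChoose q i) •
        heisenbergMode μ (p - j) (heisenbergMode μ (q - i) (C (n + (j + i)) u))) N
        (fun j i hj => ?_) (fun j => ⟨N, fun i hi => ?_⟩)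
      all_goals
        have := (hN (j + i) (by omega)).1
        push_cast at this
        simp [this]
    · refine hasFiniteSupport_uncurry' (f := fun j i => (altChoose p j * altChoose q i * (-1) ^ q) •
        heisenbergMode μ (p - j) (C (n + q + j - i) (heisenbergMode μ i u))) N
        (fun j i hi => by simp [(hN i hi).2]) (fun i => ?_)
      obtain ⟨K, hK⟩ := hC (heisenbergMode μ i u)
      exact ⟨(K - n - q + i).toNat, fun j hj => by simp [hK (n + q + j - i) (by omega)]⟩
    · refine hasFiniteSupport_uncurry (f := fun j i => (altChoose p j * altChoose q i * (-1) ^ p) •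
        heisenbergMode μ (q - i) (C (n + p + i - j) (heisenbergMode μ j u))) N
        (fun j i hi => by simp [(hN j hi).2]) (fun j => ?_)
      obtain ⟨K, hK⟩ := hC (heisenbergMode μ j u)
      exact ⟨(K - n - p + j).toNat, fun i hi => by simp [hK (n + p + i - j) (by omega)]⟩
    · refine hasFiniteSupport_uncurry (f := fun j i => (altChoose p j * altChoose q i * (-1) ^ p *
        (-1) ^ q) • C (n + p + q - j - i) (heisenbergMode μ i (heisenbergMode μ j u))) N
        (fun j i hi => by simp [(hN j hi).2]) (fun j => ?_)
      obtain ⟨K, hK⟩ := heisenbergMode_truncated μ (heisenbergMode μ j u)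
      exact ⟨K, fun i hi => by simp [hK i hi]⟩
  rw [expand p q D hD, expand q p E hE, finsum_prod_comm (fin p q)]
  refine finsum_congr fun i => finsum_congr fun j => ?_
  simp only [T]
  rw [heisenbergMode_comm μ (p - j), if_neg (by omega), zero_smul, add_zero,
    mul_comm (altChoose p j), add_comm (j : ℤ) i, show n + q + ↑j - ↑i = n + q + j - i by ring,
    show n + q + p - ↑i - ↑j = n + p + q - j - i by ring]
  have hc : heisenbergMode μ i (heisenbergMode μ j u) =
      heisenbergMode μ j (heisenbergMode μ i u) := by
    rw [heisenbergMode_comm μ i j]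
    split_ifs with h
    · rw [show (i : ℤ) = 0 by omega]
      simp
    · simp
  rw [hc]
  module

end Heisenberg

/-! ### The modes of the vertex operators of `M(1)` -/

section Modes

/-- Normally ordered products of derivatives of `h(z)` may be reordered, so the sorting in `fockY`
is immaterial. -/
theorem currentProduct_perm (μ : ℂ) {l l' : List ℕ} (h : l.Perm l') :
    currentProduct μ l = currentProduct μ l' := by
  induction h with
  | nil => rfl
  | cons k _ ih => rw [currentProduct, currentProduct, ih]
  | swap k j l =>
    apply ncoeff_injective
    intro n
    refine LinearMap.ext fun u => ?_
    simp only [currentProduct, ncoeff_normalOrder_dividedDeriv]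
    exact currentIterate_comm μ (by omega) (by omega) (ncoeff_truncated (currentProduct μ l))
      (fun n u => ncoeff_normalOrder_dividedDeriv μ _ _ n u)
      (fun n u => ncoeff_normalOrder_dividedDeriv μ _ _ n u) n u
  | trans _ _ ih1 ih2 => exact ih1.trans ih2

/-- The mode `aₙ` of the vertex operator `Y(a,z) = ∑ₙ aₙ z^(-n-1)` of `a ∈ M(1)` on `M(1,μ)`, linear
in `a`. -/
def fockMode (μ : ℂ) (n : ℤ) : Fock →ₗ[ℂ] Fock →ₗ[ℂ] Fock :=
  LinearMap.proj n ∘ₗ VertexOperator.ncoeff ∘ₗ fockY μ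

theorem fockMode_eq (μ : ℂ) (n : ℤ) (a : Fock) :
    fockMode μ n a = VertexOperator.ncoeff (fockY μ a) n := rfl

theorem fockMode_truncated (μ : ℂ) (a u : Fock) :
    ∃ N : ℤ, ∀ n, N ≤ n → fockMode μ n a u = 0 :=
  ncoeff_truncated (fockY μ a) u

theorem fockMode_C (μ c : ℂ) (n : ℤ) (u : Fock) :
    fockMode μ n (C c) u = (if n = -1 then c else 0) • u := by
  have h : (C c : Fock) = c • basisMonomials ℕ ℂ 0 := by
    rw [coe_basisMonomials, smul_monomial, smul_eq_mul, mul_one, C_apply]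
  have h2 : fockY μ (basisMonomials ℕ ℂ 0) = idField Fock := by
    rw [fockY, Module.Basis.constr_basis]
    simp [currentProduct]
  rw [fockMode_eq, h, map_smul, map_smul, h2, idField, Pi.smul_apply, ncoeff_ofModes]
  split_ifs <;> simp

/-- Left multiplication by `h(-k-1)` corresponds to the normally ordered product with `∂^(k)h(z)`,
whatever the position of `k` in the sorted list of indices. -/
theorem fockMode_X_mul (μ : ℂ) (n : ℤ) (k : ℕ) (a u : Fock) :
    fockMode μ n (X k * a) u =
      currentIterate μ (-k - 1) (fun m => fockMode μ m a) n u := by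
  have key : fockY μ (X k * a) = normalOrder (dividedDeriv k (heisenbergField μ)) (fockY μ a) := by
    have hY : ∀ s c, fockY μ (monomial s c) =
        c • currentProduct μ ((Finsupp.toMultiset s).sort (· ≤ ·)) := by
      intro s c
      rw [show (monomial s c : Fock) = c • basisMonomials ℕ ℂ s by
        rw [coe_basisMonomials, smul_monomial, smul_eq_mul, mul_one], map_smul, fockY,
        Module.Basis.constr_basis]
    induction a using MvPolynomial.induction_on' with
    | monomial s c =>
      have hperm : ((Finsupp.toMultiset (Finsupp.single k 1 + s)).sort (· ≤ ·)).Perm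
          (k :: (Finsupp.toMultiset s).sort (· ≤ ·)) := by
        rw [← Multiset.coe_eq_coe, Multiset.sort_eq, ← Multiset.cons_coe, Multiset.sort_eq,
          map_add, Finsupp.toMultiset_single, one_smul, Multiset.singleton_add]
      rw [show (X k * monomial s c : Fock) = monomial (Finsupp.single k 1 + s) c by
        rw [X, monomial_mul, one_mul], hY, hY, currentProduct_perm μ hperm, currentProduct]
      apply ncoeff_injective
      intro n
      refine LinearMap.ext fun u => ?_
      simp only [map_smul, Pi.smul_apply, LinearMap.smul_apply, ncoeff_normalOrder_dividedDeriv]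
      simp only [currentIterate, Pi.smul_apply, LinearMap.smul_apply, map_smul]
      rw [smul_finsum]
      exact finsum_congr fun j => by module
    | add b c hb hc =>
      rw [mul_add, map_add, hb, hc, map_add]
      apply ncoeff_injective
      intro n
      refine LinearMap.ext fun u => ?_
      simp only [map_add, Pi.add_apply, LinearMap.add_apply, ncoeff_normalOrder_dividedDeriv]
      simp only [currentIterate]
      rw [← finsum_add_distrib
        (hasFiniteSupport_currentIterate μ _ (ncoeff_truncated (fockY μ b)) n u)
        (hasFiniteSupport_currentIterate μ _ (ncoeff_truncated (fockY μ c)) n u)]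
      refine finsum_congr fun j => ?_
      simp only [Pi.add_apply, LinearMap.add_apply, map_add]
      module
  rw [fockMode_eq, key, ncoeff_normalOrder_dividedDeriv]
  rfl

end Modes

/-! ### The commutator formula for `h(z)` -/

section Commutator

/-- The iterate formula for `h(z)`: for `p < 0`, the modes of `h(p)a` are those of the `p`-th
product of `h(z)` with `Y(a,z)`. -/
theorem fockMode_heisenbergMode (μ : ℂ) (n : ℤ) {p : ℤ} (hp : p < 0) (a u : Fock) :
    fockMode μ n (heisenbergMode 0 p a) u =
      currentIterate μ p (fun m => fockMode μ m a) n u := by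
  obtain ⟨k, rfl⟩ : ∃ k : ℕ, p = -k - 1 := ⟨(-p - 1).toNat, by omega⟩
  rw [heisenbergMode_neg_sub, fockMode_X_mul]

/-- `h(j)𝟏 = 0` in `M(1)` for `j ≥ 0`; for `j = 0` this needs `μ = 0`. -/
theorem heisenbergMode_zero_nonneg_C (j : ℕ) (c : ℂ) : heisenbergMode 0 j (C c) = 0 := by
  cases j with
  | zero => simp [heisenbergMode_zero']
  | succ j => rw [Nat.cast_succ, heisenbergMode_natCast_succ, pderiv_C, smul_zero]

/-- The coefficient produced by the central terms of the Heisenberg algebra when `h(m)` is commuted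
past the product of `h(z)` with another field. -/
theorem finsum_central (m : ℤ) (k : ℕ) (G : ℤ → Fock) :
    ∑ᶠ j : ℕ, altChoose (-k - 1) j • ((if m + (-k - 1 - j) = 0 then (m : ℂ) else 0) • G j -
      (-1 : ℂ) ^ (-k - 1 : ℤ) • (if m + j = 0 then (m : ℂ) else 0) • G (-k - 1 - j)) =
    (((k : ℂ) + 1) * intChoose m (k + 1)) • G (m - k - 1) := by
  have hsig : (-1 : ℂ) ^ (-k - 1 : ℤ) = -(-1) ^ k := by
    rw [zpow_sub₀ (by norm_num), zpow_neg, zpow_natCast]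
    rcases neg_one_pow_eq_or ℂ k with h | h <;> simp [h]
  rw [hsig, succ_mul_intChoose_succ]
  rcases le_or_gt m 0 with hm | hm
  · obtain ⟨i, rfl⟩ : ∃ i : ℕ, m = -i := ⟨(-m).toNat, by omega⟩
    rw [finsum_eq_single _ i]
    · rw [if_neg (by omega), if_pos (by omega), show (-k - 1 - i : ℤ) = -i - k - 1 by ring,
        zero_smul, zero_sub, smul_smul, ← neg_smul, smul_smul]
      congr 1
      rw [altChoose_neg_succ]
      rcases Nat.eq_zero_or_pos i with rfl | hi
      · rcases Nat.eq_zero_or_pos k with rfl | hk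
        · simp
        · have := intChoose_eq_zero hk
          simp_all
      · obtain ⟨i, rfl⟩ : ∃ i', i = i' + 1 := ⟨i - 1, by omega⟩
        rw [show (-(i + 1 : ℕ) : ℤ) = -(i : ℤ) - 1 by push_cast; ring, intChoose_neg_succ]
        have h1 : ((i + k).choose k : ℂ) * (i + 1 + k) =
            ((k + (i + 1)).choose (i + 1)) * (i + 1) := by
          have := Nat.add_one_mul_choose_eq (i + k) i
          rw [show i + k + 1 = k + (i + 1) by ring, Nat.choose_symm_add] at this
          have := congrArg (Nat.cast (R := ℂ)) this
          push_cast at this ⊢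
          linear_combination this
        push_cast
        linear_combination (-1) ^ k * h1
    · intro j hj
      rw [if_neg (by omega), if_neg (by omega)]
      simp
  · rcases lt_or_ge m (k + 1) with hk | hk
    · obtain ⟨i, rfl⟩ : ∃ i : ℕ, m = i := ⟨m.toNat, by omega⟩
      rw [finsum_eq_zero_of_forall_eq_zero]
      · rcases Nat.lt_or_ge i k with h | h
        · rw [intChoose_eq_zero h]
          simp
        · rw [show i = k by omega]
          simp
      · intro j
        rw [if_neg (by omega), if_neg (by omega)]
        simp
    · obtain ⟨i, rfl⟩ : ∃ i : ℕ, m = (k + 1 + i : ℕ) := ⟨(m - k - 1).toNat, by omega⟩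
      rw [finsum_eq_single _ i]
      · rw [if_pos (by push_cast; ring), if_neg (by omega),
          show (((k + 1 + i : ℕ) : ℤ) - k - 1 : ℤ) = i by push_cast; ring, zero_smul, smul_zero,
          sub_zero, smul_smul, altChoose_neg_succ, intChoose_nat]
        congr 1
        have := Nat.choose_mul_succ_eq (k + i) k
        rw [show k + i + 1 - k = i + 1 by omega, Nat.choose_symm_add] at this
        have := congrArg (Nat.cast (R := ℂ)) this
        rw [show k + i + 1 = k + 1 + i by ring] at this
        push_cast at this ⊢
        linear_combination this
      · intro j hj
        rw [if_neg (by omega), if_neg (by omega)]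
        simp

/-- The sum in the commutator formula over a finite range that depends only on `b`, and so can be
interchanged with other infinite sums. -/
theorem finsum_fockMode_eq_sum (μ : ℂ) (b : Fock) (T : ℕ)
    (hT : ∀ t : ℕ, T ≤ t → heisenbergMode 0 t b = 0) (c : ℕ → ℂ) (f : ℕ → ℤ) (u : Fock) :
    ∑ᶠ t : ℕ, c t • fockMode μ (f t) (heisenbergMode 0 t b) u =
      ∑ t ∈ Finset.range T, c t • fockMode μ (f t) (heisenbergMode 0 t b) u :=
  finsum_eq_sum_range T fun t ht => by rw [hT t ht]; simp

/-- The commutator formula `[h(m), bₙ] = ∑ₜ (m choose t) (h(t)b)_{m+n-t}` on `M(1,μ)`. -/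
theorem heisenbergMode_fockMode (μ : ℂ) (b : Fock) (m n : ℤ) (u : Fock) :
    heisenbergMode μ m (fockMode μ n b u) = fockMode μ n b (heisenbergMode μ m u) +
      ∑ᶠ t : ℕ, intChoose m t • fockMode μ (m + n - t) (heisenbergMode 0 t b) u := by
  induction b using MvPolynomial.induction_on generalizing n u with
  | C c =>
    simp only [heisenbergMode_zero_nonneg_C, fockMode_C]
    split_ifs <;> simp
  | add b c hb hc =>
    obtain ⟨T, hT⟩ := heisenbergMode_truncated 0 b
    obtain ⟨T', hT'⟩ := heisenbergMode_truncated 0 c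
    simp only [map_add, LinearMap.add_apply, hb, hc, smul_add]
    rw [finsum_add_distrib]
    · abel
    · exact hasFiniteSupport_of_ge T fun t ht => by rw [hT t ht]; simp
    · exact hasFiniteSupport_of_ge T' fun t ht => by rw [hT' t ht]; simp
  | mul_X b k hb =>
    rw [mul_comm]
    obtain ⟨T, hT⟩ := heisenbergMode_truncated 0 b
    have hX : ∀ t : ℕ, heisenbergMode 0 t (X k * b) = X k * heisenbergMode 0 t b +
        (if (t : ℤ) + (-k - 1) = 0 then (((t : ℤ) : ℂ)) else 0) • b := by
      intro t
      rw [← heisenbergMode_neg_sub 0 k b, heisenbergMode_comm, heisenbergMode_neg_sub]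
    have hB := fockMode_truncated μ b
    -- `h(t)` also hits the new factor `h(-k-1)`, which contributes the term `t = k + 1`.
    have hR : ∑ᶠ t : ℕ, intChoose m t • fockMode μ (m + n - t) (heisenbergMode 0 t (X k * b)) u =
        ∑ t ∈ Finset.range T, intChoose m t • fockMode μ (m + n - t)
          (X k * heisenbergMode 0 t b) u +
        (((k : ℂ) + 1) * intChoose m (k + 1)) • fockMode μ (m + n - (k + 1)) b u := by
      simp only [hX, map_add, LinearMap.add_apply, smul_add]
      rw [finsum_add_distrib]
      · congr 1
        · exact finsum_eq_sum_range T fun t ht => by rw [hT t ht]; simp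
        · rw [finsum_eq_single _ (k + 1)]
          · rw [if_pos (by push_cast; ring)]
            simp [smul_smul, mul_comm]
          · intro t ht
            rw [if_neg (by omega)]
            simp
      · exact hasFiniteSupport_of_ge T fun t ht => by rw [hT t ht]; simp
      · exact hasFiniteSupport_of_ge (k + 2) fun t ht => by rw [if_neg (by omega)]; simp
    rw [hR]
    simp only [fockMode_X_mul]
    have f1 := hasFiniteSupport_currentIterate μ (-k - 1) hB n (heisenbergMode μ m u)
    have f2 : ∀ t : ℕ, Function.HasFiniteSupport fun j : ℕ => intChoose m t •
        (altChoose (-k - 1) j • (heisenbergMode μ (-k - 1 - j)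
          (fockMode μ (m + n - t + j) (heisenbergMode 0 t b) u) -
        (-1 : ℂ) ^ (-k - 1 : ℤ) • fockMode μ (m + n - t + (-k - 1) - j) (heisenbergMode 0 t b)
          (heisenbergMode μ j u))) := fun t =>
      (hasFiniteSupport_currentIterate μ (-k - 1) (fockMode_truncated μ (heisenbergMode 0 t b))
        (m + n - t) u).fun_comp (g := fun x => intChoose m t • x) (smul_zero _)
    have f3 : Function.HasFiniteSupport fun j : ℕ => ∑ t ∈ Finset.range T, intChoose m t •
        (altChoose (-k - 1) j • (heisenbergMode μ (-k - 1 - j)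
          (fockMode μ (m + n - t + j) (heisenbergMode 0 t b) u) -
        (-1 : ℂ) ^ (-k - 1 : ℤ) • fockMode μ (m + n - t + (-k - 1) - j) (heisenbergMode 0 t b)
          (heisenbergMode μ j u))) := by
      choose K hK using fun t : ℕ => currentIterate_support μ
        (fockMode_truncated μ (heisenbergMode 0 t b)) (m + n - t) u
      obtain ⟨S, hS⟩ := ((Finset.range T).image K).bddAbove
      refine hasFiniteSupport_of_ge S fun j hj => Finset.sum_eq_zero fun t ht => ?_
      have := hK t j ((hS (Finset.mem_coe.2 (Finset.mem_image_of_mem K ht))).trans hj)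
      simp [this]
    -- The commutators of `h(m)` with the Heisenberg modes contribute the same term on the left.
    have hC := finsum_central m k fun j => fockMode μ (n + j) b u
    have f4 : Function.HasFiniteSupport fun j : ℕ => altChoose (-k - 1) j •
        ((if m + (-k - 1 - j) = 0 then (m : ℂ) else 0) • fockMode μ (n + j) b u -
      (-1 : ℂ) ^ (-k - 1 : ℤ) • (if m + j = 0 then (m : ℂ) else 0) •
        fockMode μ (n + (-k - 1 - j)) b u) :=
      hasFiniteSupport_of_ge (m.natAbs + k + 2) fun j hj => by
        rw [if_neg (by omega), if_neg (by omega)]; simp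
    rw [show m + n - (k + 1) = n + (m - k - 1) by ring, ← hC]
    simp only [currentIterate]
    rw [map_finsum _ (hasFiniteSupport_currentIterate μ (-k - 1) hB n u)]
    simp only [smul_finsum]
    rw [← finsum_sum_comm _ _ fun t _ => f2 t, ← finsum_add_distrib f3 f4,
      ← finsum_add_distrib f1 (f3.fun_add f4)]
    refine finsum_congr fun j => ?_
    simp only [map_smul, map_sub]
    rw [heisenbergMode_comm μ m (-k - 1 - j), hb, hb, heisenbergMode_comm μ m j,
      finsum_fockMode_eq_sum μ b T hT, finsum_fockMode_eq_sum μ b T hT]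
    simp only [smul_sub, Finset.sum_sub_distrib, map_add, map_smul, map_sum, smul_add,
      Finset.smul_sum]
    have e1 : ∀ t : ℕ, m + (n + (j : ℤ)) - t = m + n - t + j := fun t => by ring
    have e2 : ∀ t : ℕ, m + (n + (-k - 1) - (j : ℤ)) - t = m + n - t + (-k - 1) - j :=
      fun t => by ring
    have e3 : n + (-k - 1 - j : ℤ) = n + (-k - 1) - j := by ring
    simp only [e1, e2, e3, smul_comm (intChoose m _)]
    abel

end Commutator

/-! ### The Borcherds identity -/

section Borcherds

theorem hasFiniteSupport_finsum {M : Type*} [AddCommGroup M] {f : ℕ → ℕ → M}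
    (hf : Function.HasFiniteSupport fun x : ℕ × ℕ => f x.1 x.2) :
    Function.HasFiniteSupport fun j => ∑ᶠ i, f i j := by
  refine (Set.Finite.image Prod.snd hf).subset fun j hj => ?_
  obtain ⟨i, hi⟩ : ∃ i, f i j ≠ 0 := by
    by_contra! h
    exact hj (finsum_eq_zero_of_forall_eq_zero h)
  exact ⟨(i, j), hi, rfl⟩

theorem hasFiniteSupport_fiber {M : Type*} [AddCommGroup M] {f : ℕ → ℕ → M}
    (hf : Function.HasFiniteSupport fun x : ℕ × ℕ => f x.1 x.2) (j : ℕ) :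
    Function.HasFiniteSupport fun i => f i j :=
  Set.Finite.preimage (f := fun i => (i, j)) (Prod.mk_left_injective j).injOn hf

/-- The `j`-th summand of `currentIterate`, for a family `X` of maps that are not assumed linear.
The sums in the Borcherds identity play the role of `X`, as functions of the index `m` and of
`u`. -/
def currentTerm (μ : ℂ) (p : ℤ) (X : ℤ → Fock → Fock) (m : ℤ) (u : Fock) (j : ℕ) : Fock :=
  altChoose p j • (heisenbergMode μ (p - j) (X (m + j) u) -
    (-1 : ℂ) ^ p • X (m + p - j) (heisenbergMode μ j u))

/-- Rearrangement of a double sum into the sum of the `currentTerm`s of `X` and finitely many double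
sums `g t`, given that summation of `f` and `f'` over the first index gives the two halves of the
`currentTerm`s. -/
theorem finsum_currentTerm {μ : ℂ} {p : ℤ} {X : ℤ → Fock → Fock} {m : ℤ} {u : Fock}
    {f f' : ℕ → ℕ → Fock} {g : ℕ → ℕ → ℕ → Fock} (T : ℕ)
    (hf : Function.HasFiniteSupport fun x : ℕ × ℕ => f x.1 x.2)
    (hf' : Function.HasFiniteSupport fun x : ℕ × ℕ => f' x.1 x.2)
    (hg : ∀ t ∈ Finset.range T, Function.HasFiniteSupport fun x : ℕ × ℕ => g t x.1 x.2)
    (h : ∀ j, ∑ᶠ i, f i j = altChoose p j • heisenbergMode μ (p - j) (X (m + j) u))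
    (h' : ∀ j, ∑ᶠ i, f' i j =
      altChoose p j • (-1 : ℂ) ^ p • X (m + p - j) (heisenbergMode μ j u)) :
    Function.HasFiniteSupport (currentTerm μ p X m u) ∧
    ∑ᶠ i, ∑ᶠ j, (f i j - f' i j - ∑ t ∈ Finset.range T, g t i j) =
      ∑ᶠ j, currentTerm μ p X m u j - ∑ t ∈ Finset.range T, ∑ᶠ i, ∑ᶠ j, g t i j := by
  obtain ⟨G1, G2⟩ := finsum_prod_sum (f := fun t i j => -g t i j) (Finset.range T)
    (fun t ht => (hg t ht).fun_neg)
  have key : currentTerm μ p X m u = fun j => ∑ᶠ i, (f i j - f' i j) := by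
    funext j
    rw [finsum_sub_distrib (hasFiniteSupport_fiber hf j) (hasFiniteSupport_fiber hf' j), h, h',
      currentTerm, smul_sub]
  have hff := hasFiniteSupport_finsum (f := fun i j => f i j - f' i j) (hf.fun_sub hf')
  rw [← key] at hff
  refine ⟨hff, ?_⟩
  rw [key, ← finsum_prod_comm (f := fun i j => f i j - f' i j) (hf.fun_sub hf')]
  simp only [sub_eq_add_neg _ (∑ t ∈ Finset.range T, _), ← Finset.sum_neg_distrib,
    ← finsum_neg_distrib]
  rw [finsum_prod_add (f := fun i j => f i j - f' i j) (hf.fun_sub hf') G1, G2]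

/-- `∑ᵢ (-1)^i (l choose i) a_{m+l-i} b_{n+i}`, the coefficient of
`z₀^(-l-1) z₁^(-m-1) z₂^(-n-1)` in `z₀⁻¹ δ((z₁-z₂)/z₀) Y(a,z₁) Y(b,z₂)`. -/
def prodSum (μ : ℂ) (a b : Fock) (l n m : ℤ) (u : Fock) : Fock :=
  ∑ᶠ i : ℕ, altChoose l i • fockMode μ (m + l - i) a (fockMode μ (n + i) b u)

/-- `∑ᵢ (-1)^i (l choose i) b_{n+l-i} a_{m+i}`, up to the sign `(-1)^l` the coefficient of
`z₀^(-l-1) z₁^(-m-1) z₂^(-n-1)` in `z₀⁻¹ δ((z₂-z₁)/(-z₀)) Y(b,z₂) Y(a,z₁)`. -/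
def oppSum (μ : ℂ) (a b : Fock) (l n m : ℤ) (u : Fock) : Fock :=
  ∑ᶠ i : ℕ, altChoose l i • fockMode μ (n + l - i) b (fockMode μ (m + i) a u)

/-- `∑ᵢ (m choose i) (a_{l+i} b)_{m+n-i}`, the coefficient of `z₀^(-l-1) z₁^(-m-1) z₂^(-n-1)` in
`z₂⁻¹ δ((z₁-z₀)/z₂) Y(Y(a,z₀)b,z₂)`. -/
def iterSum (μ : ℂ) (a b : Fock) (l n m : ℤ) (u : Fock) : Fock :=
  ∑ᶠ i : ℕ, intChoose m i • fockMode μ (m + n - i) (fockMode 0 (l + i) a b) u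

theorem fockMode_truncated_nat (μ : ℂ) (a u : Fock) (n : ℤ) :
    ∃ N : ℕ, ∀ i : ℕ, N ≤ i → fockMode μ (n + i) a u = 0 := by
  obtain ⟨N, hN⟩ := fockMode_truncated μ a u
  exact ⟨(N - n).toNat, fun i hi => hN _ (by omega)⟩

theorem neg_one_zpow_sub_natCast (p : ℤ) (t : ℕ) : (-1 : ℂ) ^ (p - t) = (-1) ^ p * (-1) ^ t := by
  rw [zpow_sub₀ (by norm_num), zpow_natCast]
  rcases neg_one_pow_eq_or ℂ t with h | h <;> simp [h, div_neg]

/-- Behaviour of `prodSum` when `a` is replaced by `h(p)a`: expand the modes of `h(p)a` by the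
iterate formula, and commute the annihilation operators `h(j)` to the right past `b_{n+i}`. -/
theorem prodSum_current (μ : ℂ) {p : ℤ} (hp : p < 0) (a b : Fock) (T : ℕ)
    (hT : ∀ t : ℕ, T ≤ t → heisenbergMode 0 t b = 0) (l n m : ℤ) (u : Fock) :
    Function.HasFiniteSupport (currentTerm μ p (prodSum μ a b l n) m u) ∧
    prodSum μ (heisenbergMode 0 p a) b l n m u =
      ∑ᶠ j, currentTerm μ p (prodSum μ a b l n) m u j -
      ∑ t ∈ Finset.range T, ((-1) ^ p * altChoose p t) •
        prodSum μ a (heisenbergMode 0 t b) (l + p - t) n m u := by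
  let f : ℕ → ℕ → Fock := fun i j => (altChoose l i * altChoose p j) •
    heisenbergMode μ (p - j) (fockMode μ (m + j + l - i) a (fockMode μ (n + i) b u))
  let f' : ℕ → ℕ → Fock := fun i j => (altChoose l i * altChoose p j * (-1) ^ p) •
    fockMode μ (m + p - j + l - i) a (fockMode μ (n + i) b (heisenbergMode μ j u))
  let g : ℕ → ℕ → ℕ → Fock := fun t i j =>
    (altChoose l i * altChoose p j * (-1) ^ p * intChoose j t) •
      fockMode μ (m + l + p - (i + j : ℕ)) a
        (fockMode μ (n + (i + j : ℕ) - t) (heisenbergMode 0 t b) u)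
  obtain ⟨N, hN⟩ := fockMode_truncated_nat μ b u n
  obtain ⟨N', hN'⟩ := heisenbergMode_truncated μ u
  have hf : Function.HasFiniteSupport fun x : ℕ × ℕ => f x.1 x.2 := by
    refine hasFiniteSupport_uncurry N (fun i j hi => by simp [f, hN i hi]) fun i => ?_
    obtain ⟨K, hK⟩ := fockMode_truncated_nat μ a (fockMode μ (n + i) b u) (m + l - i)
    refine ⟨K, fun j hj => ?_⟩
    simp [f, show m + ↑j + l - ↑i = m + l - i + j by ring, hK j hj]
  have hf' : Function.HasFiniteSupport fun x : ℕ × ℕ => f' x.1 x.2 := by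
    refine hasFiniteSupport_uncurry' N' (fun i j hj => by simp [f', hN' j hj]) fun j => ?_
    obtain ⟨K, hK⟩ := fockMode_truncated_nat μ b (heisenbergMode μ j u) n
    exact ⟨K, fun i hi => by simp [f', hK i hi]⟩
  have hG : ∀ t : ℕ, ∃ K : ℕ, ∀ s : ℕ, K ≤ s →
      fockMode μ (n + s - t) (heisenbergMode 0 t b) u = 0 := by
    intro t
    obtain ⟨K, hK⟩ := fockMode_truncated_nat μ (heisenbergMode 0 t b) u (n - t)
    exact ⟨K, fun s hs => by rw [← hK s hs]; congr 3; ring⟩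
  have hg : ∀ t ∈ Finset.range T, Function.HasFiniteSupport fun x : ℕ × ℕ => g t x.1 x.2 := by
    intro t _
    obtain ⟨K, hK⟩ := hG t
    refine hasFiniteSupport_uncurry K (fun i j hi => ?_) fun i => ⟨K, fun j hj => ?_⟩
    · simp only [g, hK (i + j) (by omega), map_zero, smul_zero]
    · simp only [g, hK (i + j) (by omega), map_zero, smul_zero]
  obtain ⟨h1, h2⟩ := finsum_currentTerm (μ := μ) (p := p) (X := prodSum μ a b l n) (m := m)
    (u := u) T hf hf' hg
    (fun j => by
      rw [prodSum, map_finsum, smul_finsum]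
      · exact finsum_congr fun i => by rw [map_smul, smul_smul, mul_comm]
      · exact hasFiniteSupport_of_ge N fun i hi => by simp [hN i hi])
    (fun j => by
      rw [prodSum, smul_finsum, smul_finsum]
      exact finsum_congr fun i => by simp only [f']; module)
  refine ⟨h1, ?_⟩
  have hsum : ∀ t ∈ Finset.range T, ∑ᶠ i, ∑ᶠ j, g t i j = ((-1) ^ p * altChoose p t) •
        prodSum μ a (heisenbergMode 0 t b) (l + p - t) n m u := by
    intro t _
    obtain ⟨K, hK⟩ := fockMode_truncated_nat μ (heisenbergMode 0 t b) u n
    have e : l + p - (t : ℤ) = l + (p - t) := by ring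
    rw [prodSum, e, ← finsum_finsum_altChoose l (p - t) (fun s =>
      fockMode μ (m + (l + (p - t)) - s) a (fockMode μ (n + s) (heisenbergMode 0 t b) u)) K
      (fun i hi => by simp [hK i hi]), smul_finsum]
    refine finsum_congr fun i => ?_
    rw [smul_finsum, finsum_shift t]
    · refine finsum_congr fun j => ?_
      simp only [g]
      rw [smul_smul, show m + l + p - ((i + (j + t) : ℕ) : ℤ) = m + (l + (p - t)) - (i + j : ℕ) by
          push_cast; ring,
        show n + ((i + (j + t) : ℕ) : ℤ) - t = n + (i + j : ℕ) by push_cast; ring]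
      congr 1
      have := intChoose_mul_choose p j t
      simp only [altChoose, pow_add]
      linear_combination ((-1) ^ i * intChoose l i * (-1) ^ p * (-1) ^ (j + t)) * this
    · intro j hj
      simp only [g, intChoose_eq_zero hj, mul_zero, zero_smul]
  rw [← Finset.sum_congr rfl hsum, ← h2, prodSum]
  refine finsum_congr fun i => ?_
  rw [fockMode_heisenbergMode μ _ hp, currentIterate, smul_finsum]
  refine finsum_congr fun j => ?_
  rw [heisenbergMode_fockMode μ b, finsum_fockMode_eq_sum μ b T hT]
  simp only [map_add, map_sum, map_smul, smul_add, smul_sub, Finset.smul_sum, smul_smul, f, f', g]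
  have e1 : m + l - (i : ℤ) + j = m + j + l - i := by ring
  have e2 : m + l - (i : ℤ) + p - j = m + p - j + l - i := by ring
  have e3 : m + l + p - ((i + j : ℕ) : ℤ) = m + p - j + l - i := by push_cast; ring
  have e4 : ∀ t : ℕ, n + ((i + j : ℕ) : ℤ) - t = j + (n + i) - t := fun t => by push_cast; ring
  simp only [e1, e2, e3, e4, mul_assoc]
  abel

/-- Behaviour of `oppSum` when `a` is replaced by `h(p)a`: expand the modes of `h(p)a` by the
iterate formula, and commute the operators `h(p-j)` to the left past `b_{n+l-i}`. The coefficients of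
the last sum differ from those in `prodSum_current` exactly by the signs `(-1)^l` and `(-1)^(l+p-t)`
with which `oppSum` enters the Borcherds identity. -/
theorem oppSum_current (μ : ℂ) {p : ℤ} (hp : p < 0) (a b : Fock) (T : ℕ)
    (hT : ∀ t : ℕ, T ≤ t → heisenbergMode 0 t b = 0) (l n m : ℤ) (u : Fock) :
    Function.HasFiniteSupport (currentTerm μ p (oppSum μ a b l n) m u) ∧
    oppSum μ (heisenbergMode 0 p a) b l n m u =
      ∑ᶠ j, currentTerm μ p (oppSum μ a b l n) m u j -
      ∑ t ∈ Finset.range T, intChoose p t •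
        oppSum μ a (heisenbergMode 0 t b) (l + p - t) n m u := by
  let f : ℕ → ℕ → Fock := fun i j => (altChoose l i * altChoose p j) •
    heisenbergMode μ (p - j) (fockMode μ (n + l - i) b (fockMode μ (m + j + i) a u))
  let f' : ℕ → ℕ → Fock := fun i j => (altChoose l i * altChoose p j * (-1) ^ p) •
    fockMode μ (n + l - i) b (fockMode μ (m + p - j + i) a (heisenbergMode μ j u))
  let g : ℕ → ℕ → ℕ → Fock := fun t i j =>
    (altChoose l i * altChoose p j * intChoose (p - j) t) •
      fockMode μ (n + l + p - t - (i + j : ℕ)) (heisenbergMode 0 t b)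
        (fockMode μ (m + (i + j : ℕ)) a u)
  obtain ⟨N, hN⟩ := fockMode_truncated_nat μ a u m
  obtain ⟨N', hN'⟩ := heisenbergMode_truncated μ u
  have hNn : ∀ i j : ℕ, N ≤ i + j → fockMode μ (m + j + i) a u = 0 := fun i j h => by
    rw [← hN (i + j) h, show m + ((i + j : ℕ) : ℤ) = m + j + i by push_cast; ring]
  have hf : Function.HasFiniteSupport fun x : ℕ × ℕ => f x.1 x.2 :=
    hasFiniteSupport_uncurry N (fun i j hi => by simp [f, hNn i j (by omega)])
      fun i => ⟨N, fun j hj => by simp [f, hNn i j (by omega)]⟩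
  have hf' : Function.HasFiniteSupport fun x : ℕ × ℕ => f' x.1 x.2 := by
    refine hasFiniteSupport_uncurry' N' (fun i j hj => by simp [f', hN' j hj]) fun j => ?_
    obtain ⟨K, hK⟩ := fockMode_truncated_nat μ a (heisenbergMode μ j u) (m + p - j)
    exact ⟨K, fun i hi => by simp [f', hK i hi]⟩
  have hg : ∀ t ∈ Finset.range T, Function.HasFiniteSupport fun x : ℕ × ℕ => g t x.1 x.2 := by
    intro t _
    refine hasFiniteSupport_uncurry N (fun i j hi => ?_) fun i => ⟨N, fun j hj => ?_⟩
    · simp only [g, hN (i + j) (by omega), map_zero, smul_zero]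
    · simp only [g, hN (i + j) (by omega), map_zero, smul_zero]
  obtain ⟨h1, h2⟩ := finsum_currentTerm (μ := μ) (p := p) (X := oppSum μ a b l n) (m := m)
    (u := u) T hf hf' hg
    (fun j => by
      rw [oppSum, map_finsum, smul_finsum]
      · exact finsum_congr fun i => by rw [map_smul, smul_smul, mul_comm]
      · exact hasFiniteSupport_of_ge N fun i hi => by simp [hNn i j (by omega)])
    (fun j => by
      rw [oppSum, smul_finsum, smul_finsum]
      exact finsum_congr fun i => by simp only [f']; module)
  refine ⟨h1, ?_⟩
  have hsum : ∀ t ∈ Finset.range T, ∑ᶠ i, ∑ᶠ j, g t i j = intChoose p t •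
        oppSum μ a (heisenbergMode 0 t b) (l + p - t) n m u := by
    intro t _
    have e : l + p - (t : ℤ) = l + (p - t) := by ring
    rw [oppSum, e, ← finsum_finsum_altChoose l (p - t) (fun s => fockMode μ (n + (l + (p - t)) - s)
      (heisenbergMode 0 t b) (fockMode μ (m + s) a u)) N (fun i hi => by simp [hN i hi]),
      smul_finsum]
    refine finsum_congr fun i => ?_
    rw [smul_finsum]
    refine finsum_congr fun j => ?_
    simp only [g]
    rw [smul_smul, show n + l + p - t - ((i + j : ℕ) : ℤ) = n + (l + (p - t)) - (i + j : ℕ) by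
      push_cast; ring]
    congr 1
    have := intChoose_mul_comm p j t
    simp only [altChoose]
    linear_combination ((-1) ^ i * intChoose l i * (-1) ^ j) * this
  rw [← Finset.sum_congr rfl hsum, ← h2, oppSum]
  refine finsum_congr fun i => ?_
  rw [fockMode_heisenbergMode μ _ hp, currentIterate, map_finsum _
    (hasFiniteSupport_currentIterate μ p (fockMode_truncated μ a) (m + i) u), smul_finsum]
  refine finsum_congr fun j => ?_
  have hcomm := heisenbergMode_fockMode μ b (p - j) (n + l - i) (fockMode μ (m + i + j) a u)
  rw [finsum_fockMode_eq_sum μ b T hT, ← sub_eq_iff_eq_add] at hcomm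
  rw [map_smul, map_sub, ← hcomm]
  simp only [map_smul, smul_sub, Finset.smul_sum, smul_smul, f, f', g]
  have e1 : m + (i : ℤ) + j = m + j + i := by ring
  have e2 : m + (i : ℤ) + p - j = m + p - j + i := by ring
  have e3 : m + ((i + j : ℕ) : ℤ) = m + j + i := by push_cast; ring
  have e4 : ∀ t : ℕ, n + l + p - t - ((i + j : ℕ) : ℤ) = p - j + (n + l - i) - t :=
    fun t => by push_cast; ring
  simp only [e1, e2, e3, e4, mul_assoc]
  abel

/-- The part of `iterSum` for `h(p)a` that involves a fixed vector `c = a_{l+s} b`, in terms of the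
modes of `c`. -/
theorem sum_antidiagonal_fockMode (μ : ℂ) {p : ℤ} (hp : p < 0) (c : Fock) (s : ℕ) (m n : ℤ)
    (u : Fock) :
    ∑ x ∈ antidiagonal s, (intChoose m x.1 * altChoose p x.2) •
        fockMode μ (m + n - x.1) (heisenbergMode 0 (p - x.2) c) u =
      ∑ᶠ j : ℕ, ((altChoose p j * intChoose (m + j) s) •
          heisenbergMode μ (p - j) (fockMode μ (m + j + n - s) c u) -
        (altChoose p j * (-1) ^ p * intChoose (m + p - j) s) •
          fockMode μ (m + p - j + n - s) c (heisenbergMode μ j u)) := by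
  obtain ⟨N, hN⟩ := currentIterate_support μ (fockMode_truncated μ c) (m + n - s) u
  have hN1 : ∀ j : ℕ, N ≤ j → fockMode μ (m + j + n - s) c u = 0 := fun j hj => by
    rw [show m + j + n - (s : ℤ) = m + n - s + j by ring]; exact (hN j hj).1
  have key : ∀ x ∈ antidiagonal s, (intChoose m x.1 * altChoose p x.2) •
        fockMode μ (m + n - x.1) (heisenbergMode 0 (p - x.2) c) u =
      ∑ᶠ j : ℕ, ((altChoose p j * (intChoose m x.1 * intChoose j x.2)) •
          heisenbergMode μ (p - j) (fockMode μ (m + j + n - s) c u) -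
        (altChoose p j * (-1) ^ p * (intChoose m x.1 * intChoose (p - j) x.2)) •
          fockMode μ (m + p - j + n - s) c (heisenbergMode μ j u)) := by
    rintro ⟨q, i⟩ hx
    have hs : q + i = s := mem_antidiagonal.1 hx
    dsimp only
    rw [fockMode_heisenbergMode μ _ (by omega), currentIterate, smul_finsum]
    simp only [smul_sub, smul_smul]
    rw [finsum_sub_distrib, finsum_sub_distrib]
    · congr 1
      · rw [finsum_shift (f := fun j : ℕ => (altChoose p j * (intChoose m q * intChoose j i)) •
          heisenbergMode μ (p - j) (fockMode μ (m + j + n - s) c u)) i]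
        · refine finsum_congr fun r => ?_
          rw [show p - ((r + i : ℕ) : ℤ) = p - i - r by push_cast; ring,
            show m + ((r + i : ℕ) : ℤ) + n - s = m + n - q + r by rw [← hs]; push_cast; ring]
          congr 1
          have := intChoose_mul_choose p r i
          simp only [altChoose, pow_add]
          linear_combination (-intChoose m q * (-1) ^ r * (-1) ^ i) * this
        · intro j hj
          simp only [intChoose_eq_zero hj, mul_zero, zero_smul]
      · refine finsum_congr fun r => ?_
        rw [show m + p - r + n - (s : ℤ) = m + n - q + (p - i) - r by rw [← hs]; push_cast; ring,
          neg_one_zpow_sub_natCast]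
        congr 1
        have := intChoose_mul_comm p i r
        have hsq : ((-1 : ℂ) ^ i) * (-1) ^ i = 1 := by rw [← mul_pow]; simp
        simp only [altChoose]
        linear_combination (intChoose m q * (-1) ^ r * (-1) ^ p) * this +
          (intChoose m q * (-1) ^ r * (-1) ^ p * intChoose p i * intChoose (p - i) r) * hsq
    · exact hasFiniteSupport_of_ge N fun j hj => by simp [hN1 j hj]
    · exact hasFiniteSupport_of_ge N fun j hj => by simp [(hN j hj).2]
    · refine hasFiniteSupport_of_ge N fun j hj => ?_
      have := (hN (i + j) (by omega)).1
      rw [show m + n - s + ((i + j : ℕ) : ℤ) = m + n - q + j by rw [← hs]; push_cast; ring] at this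
      simp [this]
    · exact hasFiniteSupport_of_ge N fun j hj => by simp [(hN j hj).2]
  rw [Finset.sum_congr rfl key, ← finsum_sum_comm]
  · refine finsum_congr fun j => ?_
    rw [Finset.sum_sub_distrib, ← Finset.sum_smul, ← Finset.sum_smul, ← Finset.mul_sum,
      ← Finset.mul_sum, sum_intChoose_mul, sum_intChoose_mul,
      show m + (p - j) = m + p - (j : ℤ) by ring]
  · intro x _
    exact hasFiniteSupport_of_ge N fun j hj => by simp [hN1 j hj, (hN j hj).2]

/-- Behaviour of `iterSum` when `a` is replaced by `h(p)a`. The iterate formula is used twice: on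
`M(1)` for `(h(p)a)_{l+q} b`, and on `M(1,μ)` for the vertex operators of `h(p-i) a_{l+q+i} b`. -/
theorem iterSum_current (μ : ℂ) {p : ℤ} (hp : p < 0) (a b : Fock) (T : ℕ)
    (hT : ∀ t : ℕ, T ≤ t → heisenbergMode 0 t b = 0) (l n m : ℤ) (u : Fock) :
    iterSum μ (heisenbergMode 0 p a) b l n m u =
      ∑ᶠ j, currentTerm μ p (iterSum μ a b l n) m u j -
      ∑ t ∈ Finset.range T, ((-1) ^ p * altChoose p t) •
        iterSum μ a (heisenbergMode 0 t b) (l + p - t) n m u := by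
  obtain ⟨S, hS⟩ := fockMode_truncated_nat 0 a b l
  obtain ⟨N', hN'⟩ := heisenbergMode_truncated μ u
  let f : ℕ → ℕ → Fock := fun s j => (altChoose p j * intChoose (m + j) s) •
    heisenbergMode μ (p - j) (fockMode μ (m + j + n - s) (fockMode 0 (l + s) a b) u)
  let f' : ℕ → ℕ → Fock := fun s j => (altChoose p j * (-1) ^ p * intChoose (m + p - j) s) •
    fockMode μ (m + p - j + n - s) (fockMode 0 (l + s) a b) (heisenbergMode μ j u)
  have hf : Function.HasFiniteSupport fun x : ℕ × ℕ => f x.1 x.2 := by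
    refine hasFiniteSupport_uncurry S (fun i j hi => by simp [f, hS i hi]) fun i => ?_
    obtain ⟨K, hK⟩ := fockMode_truncated_nat μ (fockMode 0 (l + i) a b) u (m + n - i)
    refine ⟨K, fun j hj => ?_⟩
    simp [f, show m + ↑j + n - ↑i = m + n - i + j by ring, hK j hj]
  have hf' : Function.HasFiniteSupport fun x : ℕ × ℕ => f' x.1 x.2 :=
    hasFiniteSupport_uncurry S (fun i j hi => by simp [f', hS i hi])
      fun i => ⟨N', fun j hj => by simp [f', hN' j hj]⟩
  obtain ⟨-, h2⟩ := finsum_currentTerm (μ := μ) (p := p) (X := iterSum μ a b l n) (m := m)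
    (u := u) (g := fun _ _ _ => 0) 0 hf hf' (by simp)
    (fun j => by
      rw [iterSum, map_finsum, smul_finsum]
      · exact finsum_congr fun i => by rw [map_smul, smul_smul]
      · exact hasFiniteSupport_of_ge S fun i hi => by simp [hS i hi])
    (fun j => by
      rw [iterSum, smul_finsum, smul_finsum]
      exact finsum_congr fun i => by simp only [f']; module)
  simp only [Finset.range_zero, Finset.sum_empty, sub_zero] at h2
  let r : ℕ → ℕ → Fock := fun q i => (intChoose m q * altChoose p i) •
    fockMode μ (m + n - q) (heisenbergMode 0 (p - i) (fockMode 0 (l + (q + i : ℕ)) a b)) u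
  have hr : Function.HasFiniteSupport fun x : ℕ × ℕ => r x.1 x.2 := by
    refine hasFiniteSupport_uncurry S (fun i j hi => ?_) fun i => ⟨S, fun j hj => ?_⟩
    · simp only [r, hS (i + j) (by omega), map_zero, LinearMap.zero_apply, smul_zero]
    · simp only [r, hS (i + j) (by omega), map_zero, LinearMap.zero_apply, smul_zero]
  have hr2 : ∑ᶠ q, ∑ᶠ i, r q i = ∑ᶠ s, ∑ᶠ j, (f s j - f' s j) := by
    rw [finsum_prod_antidiagonal hr]
    refine finsum_congr fun s => ?_
    rw [← sum_antidiagonal_fockMode μ hp]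
    refine Finset.sum_congr rfl fun x hx => ?_
    simp only [r, mem_antidiagonal.1 hx]
  let g : ℕ → ℕ → Fock := fun t q => ((-1) ^ p * altChoose p t) • intChoose m q •
    fockMode μ (m + n - q) (fockMode 0 (l + p - t + q) a (heisenbergMode 0 t b)) u
  have hg : ∀ t, Function.HasFiniteSupport (g t) := by
    intro t
    obtain ⟨K, hK⟩ := fockMode_truncated_nat 0 a (heisenbergMode 0 t b) (l + p - t)
    exact hasFiniteSupport_of_ge K fun i hi => by simp [g, hK i hi]
  have hgs : Function.HasFiniteSupport fun q => ∑ t ∈ Finset.range T, g t q := by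
    choose K hK using fun t : ℕ => fockMode_truncated_nat 0 a (heisenbergMode 0 t b) (l + p - t)
    obtain ⟨S', hS'⟩ := ((Finset.range T).image K).bddAbove
    refine hasFiniteSupport_of_ge S' fun q hq => Finset.sum_eq_zero fun t ht => ?_
    have := hK t q ((hS' (Finset.mem_coe.2 (Finset.mem_image_of_mem K ht))).trans hq)
    simp [g, this]
  have hrs : Function.HasFiniteSupport fun q => ∑ᶠ i, r q i :=
    hasFiniteSupport_of_ge S fun q hq => finsum_eq_zero_of_forall_eq_zero fun i => by
      simp only [r, hS (q + i) (by omega), map_zero, LinearMap.zero_apply, smul_zero]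
  have hgi : ∑ t ∈ Finset.range T, ((-1) ^ p * altChoose p t) •
        iterSum μ a (heisenbergMode 0 t b) (l + p - t) n m u =
      ∑ᶠ q, ∑ t ∈ Finset.range T, g t q := by
    rw [finsum_sum_comm _ _ fun t _ => hg t]
    exact Finset.sum_congr rfl fun t _ => by rw [iterSum, smul_finsum]
  rw [← h2, ← hr2, hgi, ← finsum_sub_distrib hrs hgs, iterSum]
  refine finsum_congr fun q => ?_
  have hlin : fockMode μ (m + n - q) (fockMode 0 (l + q) (heisenbergMode 0 p a) b) u =
      ∑ᶠ i : ℕ, altChoose p i • (fockMode μ (m + n - q)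
        (heisenbergMode 0 (p - i) (fockMode 0 (l + (q + i : ℕ)) a b)) u -
        (-1 : ℂ) ^ p • fockMode μ (m + n - q) (fockMode 0 (l + p - i + q) a
          (heisenbergMode 0 i b)) u) := by
    rw [fockMode_heisenbergMode 0 _ hp, currentIterate]
    have := map_finsum ((fockMode μ (m + n - q)).flip u)
      (hasFiniteSupport_currentIterate 0 p (fockMode_truncated 0 a) (l + q) b)
    simp only [LinearMap.flip_apply] at this
    rw [this]
    refine finsum_congr fun i => ?_
    rw [show l + ((q + i : ℕ) : ℤ) = l + q + i by push_cast; ring,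
      show l + p - (i : ℤ) + q = l + q + p - i by ring]
    simp
  rw [hlin, ← finsum_eq_sum_range (f := fun t => g t q) T (fun t ht => by simp [g, hT t ht]),
    smul_finsum, ← finsum_sub_distrib]
  · refine finsum_congr fun i => ?_
    simp only [r, g]
    module
  · exact hasFiniteSupport_of_ge S fun i hi => by
      simp only [r, hS (q + i) (by omega), map_zero, LinearMap.zero_apply, smul_zero]
  · exact hasFiniteSupport_of_ge T fun t ht => by simp [g, hT t ht]

theorem finsum_ite_eq {P : ℕ → Prop} [DecidablePred P] (q : ℤ) (hP : ∀ i : ℕ, P i ↔ (i : ℤ) = q)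
    (F : ℕ → Fock) : (∑ᶠ i, if P i then F i else 0) = if 0 ≤ q then F q.toNat else 0 := by
  split_ifs with hq
  · rw [finsum_eq_single _ q.toNat, if_pos ((hP _).2 (by omega))]
    intro i hi
    rw [if_neg fun h => hi (by have := (hP i).1 h; omega)]
  · refine finsum_eq_zero_of_forall_eq_zero fun i => if_neg fun h => ?_
    have := (hP i).1 h
    omega

/-- The scalar identity behind the Borcherds identity for `a = 𝟏`. -/
theorem altChoose_delta (l m : ℤ) :
    (if 0 ≤ m + l + 1 then altChoose l (m + l + 1).toNat else 0) -
      (-1 : ℂ) ^ l * (if 0 ≤ -1 - m then altChoose l (-1 - m).toNat else 0) =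
      if 0 ≤ -1 - l then intChoose m (-1 - l).toNat else 0 := by
  rcases lt_or_ge l 0 with hl | hl
  · obtain ⟨k, rfl⟩ : ∃ k : ℕ, l = -k - 1 := ⟨(-l - 1).toNat, by omega⟩
    rw [if_pos (show (0 : ℤ) ≤ -1 - (-k - 1) by omega), show (-1 - (-k - 1 : ℤ)).toNat = k by omega]
    rcases lt_or_ge m 0 with hm | hm
    · obtain ⟨r, rfl⟩ : ∃ r : ℕ, m = -r - 1 := ⟨(-m - 1).toNat, by omega⟩
      rw [if_neg (by omega), if_pos (by omega), show (-1 - (-r - 1 : ℤ)).toNat = r by omega,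
        altChoose_neg_succ, intChoose_neg_succ, ← Nat.choose_symm_add, add_comm r k,
        show (-k - 1 : ℤ) = (-1 : ℤ) - (k + 0 : ℕ) by push_cast; ring, neg_one_zpow_sub_natCast]
      simp
    · obtain ⟨r, rfl⟩ : ∃ r : ℕ, m = r := ⟨m.toNat, by omega⟩
      rw [if_neg (show ¬ (0 : ℤ) ≤ -1 - r by omega), mul_zero, sub_zero]
      split_ifs with h
      · obtain ⟨i, rfl⟩ : ∃ i : ℕ, r = k + i := ⟨r - k, by omega⟩
        rw [show (((k + i : ℕ) : ℤ) + (-k - 1) + 1).toNat = i by omega, altChoose_neg_succ,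
          intChoose_nat, Nat.choose_symm_add]
      · rw [intChoose_eq_zero (by omega)]
  · obtain ⟨k, rfl⟩ : ∃ k : ℕ, l = k := ⟨l.toNat, by omega⟩
    rw [if_neg (show ¬ (0 : ℤ) ≤ -1 - k by omega)]
    rcases lt_or_ge m 0 with hm | hm
    · obtain ⟨r, rfl⟩ : ∃ r : ℕ, m = -r - 1 := ⟨(-m - 1).toNat, by omega⟩
      rw [if_pos (show (0 : ℤ) ≤ -1 - (-r - 1) by omega),
        show (-1 - (-r - 1 : ℤ)).toNat = r by omega]
      split_ifs with h
      · obtain ⟨i, rfl⟩ : ∃ i : ℕ, k = r + i := ⟨k - r, by omega⟩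
        rw [show (-r - 1 + ((r + i : ℕ) : ℤ) + 1).toNat = i by omega, altChoose, altChoose,
          intChoose_nat, intChoose_nat, Nat.choose_symm_add, zpow_natCast, pow_add]
        have h3 : ((-1 : ℂ) ^ r) * (-1) ^ r = 1 := by rw [← mul_pow]; simp
        linear_combination (-(-1 : ℂ) ^ i * ((r + i).choose i : ℂ)) * h3
      · rw [altChoose, intChoose_eq_zero (by omega)]
        simp
    · rw [if_neg (show ¬ (0 : ℤ) ≤ -1 - m by omega), if_pos (by omega), altChoose,
        intChoose_eq_zero (by omega)]
      simp

theorem borcherds_identity_C (μ c : ℂ) (b : Fock) (l n m : ℤ) (u : Fock) :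
    prodSum μ (C c) b l n m u - (-1 : ℂ) ^ l • oppSum μ (C c) b l n m u =
      iterSum μ (C c) b l n m u := by
  have hP : prodSum μ (C c) b l n m u = (if 0 ≤ m + l + 1 then altChoose l (m + l + 1).toNat
      else 0) • c • fockMode μ (m + n + l + 1) b u := by
    have h : ∀ i : ℕ, altChoose l i • fockMode μ (m + l - i) (C c) (fockMode μ (n + i) b u) =
        if m + l - i = -1 then altChoose l i • c • fockMode μ (n + i) b u else 0 := fun i => by
      rw [fockMode_C]
      split_ifs <;> simp
    rw [prodSum, finsum_congr h, finsum_ite_eq (m + l + 1) (fun i => by omega)]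
    split_ifs with hq
    · rw [show n + ((m + l + 1).toNat : ℤ) = m + n + l + 1 by omega]
    · simp
  have hQ : oppSum μ (C c) b l n m u = (if 0 ≤ -1 - m then altChoose l (-1 - m).toNat
      else 0) • c • fockMode μ (m + n + l + 1) b u := by
    have h : ∀ i : ℕ, altChoose l i • fockMode μ (n + l - i) b (fockMode μ (m + i) (C c) u) =
        if m + i = -1 then altChoose l i • c • fockMode μ (n + l - i) b u else 0 := fun i => by
      rw [fockMode_C]
      split_ifs <;> simp
    rw [oppSum, finsum_congr h, finsum_ite_eq (-1 - m) (fun i => by omega)]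
    split_ifs with hq
    · rw [show n + l - ((-1 - m).toNat : ℤ) = m + n + l + 1 by omega]
    · simp
  have hR : iterSum μ (C c) b l n m u = (if 0 ≤ -1 - l then intChoose m (-1 - l).toNat
      else 0) • c • fockMode μ (m + n + l + 1) b u := by
    have h : ∀ i : ℕ, intChoose m i • fockMode μ (m + n - i) (fockMode 0 (l + i) (C c) b) u =
        if l + i = -1 then intChoose m i • c • fockMode μ (m + n - i) b u else 0 := fun i => by
      rw [fockMode_C]
      split_ifs <;> simp
    rw [iterSum, finsum_congr h, finsum_ite_eq (-1 - l) (fun i => by omega)]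
    split_ifs with hq
    · rw [show m + n - ((-1 - l).toNat : ℤ) = m + n + l + 1 by omega]
    · simp
  rw [hP, hQ, hR, ← altChoose_delta, sub_smul, mul_smul]

theorem prodSum_add (μ : ℂ) (a a' b : Fock) (l n m : ℤ) (u : Fock) :
    prodSum μ (a + a') b l n m u = prodSum μ a b l n m u + prodSum μ a' b l n m u := by
  obtain ⟨N, hN⟩ := fockMode_truncated_nat μ b u n
  rw [prodSum, prodSum, prodSum, ← finsum_add_distrib]
  · exact finsum_congr fun i => by simp
  all_goals exact hasFiniteSupport_of_ge N fun i hi => by simp [hN i hi]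

theorem oppSum_add (μ : ℂ) (a a' b : Fock) (l n m : ℤ) (u : Fock) :
    oppSum μ (a + a') b l n m u = oppSum μ a b l n m u + oppSum μ a' b l n m u := by
  obtain ⟨N, hN⟩ := fockMode_truncated_nat μ a u m
  obtain ⟨N', hN'⟩ := fockMode_truncated_nat μ a' u m
  rw [oppSum, oppSum, oppSum, ← finsum_add_distrib]
  · exact finsum_congr fun i => by simp
  · exact hasFiniteSupport_of_ge N fun i hi => by simp [hN i hi]
  · exact hasFiniteSupport_of_ge N' fun i hi => by simp [hN' i hi]

theorem iterSum_add (μ : ℂ) (a a' b : Fock) (l n m : ℤ) (u : Fock) :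
    iterSum μ (a + a') b l n m u = iterSum μ a b l n m u + iterSum μ a' b l n m u := by
  obtain ⟨N, hN⟩ := fockMode_truncated_nat 0 a b l
  obtain ⟨N', hN'⟩ := fockMode_truncated_nat 0 a' b l
  rw [iterSum, iterSum, iterSum, ← finsum_add_distrib]
  · exact finsum_congr fun i => by simp
  · exact hasFiniteSupport_of_ge N fun i hi => by simp [hN i hi]
  · exact hasFiniteSupport_of_ge N' fun i hi => by simp [hN' i hi]

/-- The Borcherds identity: the Jacobi identity for the module `M(1,μ)` over `M(1)`. -/
theorem borcherds_identity (μ : ℂ) (a b : Fock) (l n m : ℤ) (u : Fock) :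
    prodSum μ a b l n m u - (-1 : ℂ) ^ l • oppSum μ a b l n m u = iterSum μ a b l n m u := by
  induction a using MvPolynomial.induction_on generalizing b l n m u with
  | C c => exact borcherds_identity_C μ c b l n m u
  | add a a' ha ha' =>
    rw [prodSum_add, oppSum_add, iterSum_add, ← ha, ← ha', smul_add]
    abel
  | mul_X a k ih =>
    obtain ⟨T, hT⟩ := heisenbergMode_truncated 0 b
    rw [mul_comm, ← heisenbergMode_neg_sub 0]
    have hp : (-k - 1 : ℤ) < 0 := by omega
    generalize (-k - 1 : ℤ) = p at hp
    obtain ⟨fP, eP⟩ := prodSum_current μ hp a b T hT l n m u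
    obtain ⟨fQ, eQ⟩ := oppSum_current μ hp a b T hT l n m u
    rw [eP, eQ, iterSum_current μ hp a b T hT l n m u]
    have h1 : ∀ j, currentTerm μ p (iterSum μ a b l n) m u j =
        currentTerm μ p (prodSum μ a b l n) m u j -
          (-1 : ℂ) ^ l • currentTerm μ p (oppSum μ a b l n) m u j := by
      intro j
      simp only [currentTerm, ← ih, map_sub, map_smul]
      module
    rw [finsum_congr h1, finsum_sub_distrib fP (fQ.fun_comp (g := fun x => (-1 : ℂ) ^ l • x)
      (smul_zero _)), ← smul_finsum]
    have h2 : ∀ t : ℕ, ((-1) ^ p * altChoose p t) •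
        iterSum μ a (heisenbergMode 0 t b) (l + p - t) n m u =
      ((-1) ^ p * altChoose p t) • prodSum μ a (heisenbergMode 0 t b) (l + p - t) n m u -
        (-1 : ℂ) ^ l • intChoose p t • oppSum μ a (heisenbergMode 0 t b) (l + p - t) n m u := by
      intro t
      rw [← ih, smul_sub, smul_smul, smul_smul, neg_one_zpow_sub_natCast,
        zpow_add₀ (by norm_num), altChoose]
      congr 2
      have h3 : ((-1 : ℂ) ^ t) * (-1) ^ t = 1 := by rw [← mul_pow]; simp
      have h4 : ((-1 : ℂ) ^ p) * (-1) ^ p = 1 := by rw [← mul_zpow]; simp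
      linear_combination ((-1 : ℂ) ^ l * intChoose p t * (-1) ^ p * (-1) ^ p) * h3 +
        ((-1 : ℂ) ^ l * intChoose p t) * h4
    simp only [h2, Finset.sum_sub_distrib, smul_sub, Finset.smul_sum]
    abel

end Borcherds

/-! ### The operator `L(-1)` -/

section Translation

/-- The vector `h(-1)𝟏` is sent to the field `h(z)`. -/
theorem fockMode_X_zero (μ : ℂ) (q : ℤ) (u : Fock) :
    fockMode μ q (X 0) u = heisenbergMode μ q u := by
  have h := fockMode_X_mul μ q 0 (C 1) u
  rw [C_1, mul_one, ← C_1, currentIterate] at h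
  simp only [Nat.cast_zero, neg_zero, zero_sub, fockMode_C] at h
  rw [h]
  have ha : ∀ j, altChoose (-1) j = 1 := fun j => by simpa using altChoose_neg_succ 0 j
  simp only [ha, one_smul]
  rcases lt_or_ge q 0 with hq | hq
  · rw [finsum_eq_single _ (-1 - q).toNat]
    · rw [if_pos (by omega), if_neg (by omega), show -1 - ((-1 - q).toNat : ℤ) = q by omega]
      simp
    · intro j hj
      rw [if_neg (by omega), if_neg (by omega)]
      simp
  · rw [finsum_eq_single _ q.toNat]
    · rw [if_neg (by omega), if_pos (by omega), show (q.toNat : ℤ) = q by omega]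
      simp
    · intro j hj
      rw [if_neg (by omega), if_neg (by omega)]
      simp

/-- `L(-1)𝟏 = 0`. -/
theorem translation_C (c : ℂ) : fockMode 0 0 conformalVector (C c) = 0 := by
  have hω : conformalVector = (1 / 2 : ℂ) • (X 0 * X 0 : Fock) := by
    rw [conformalVector, smul_eq_C_mul, pow_two]
  rw [hω, map_smul, LinearMap.smul_apply, fockMode_X_mul, currentIterate,
    finsum_eq_zero_of_forall_eq_zero, smul_zero]
  intro j
  rw [fockMode_X_zero, fockMode_X_zero, zero_add, heisenbergMode_zero_nonneg_C]
  simp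

theorem heisenbergMode_conformalVector (t : ℕ) :
    heisenbergMode 0 t conformalVector = if t = 1 then X 0 else 0 := by
  rcases t with _ | t
  · simp [heisenbergMode_zero']
  · rw [Nat.cast_succ, heisenbergMode_natCast_succ, conformalVector, pderiv_C_mul,
      Derivation.leibniz_pow, pderiv_X]
    rcases Nat.eq_zero_or_pos t with rfl | ht
    · rw [if_pos rfl, Pi.single_eq_same, Nat.cast_zero, zero_add, one_smul]
      simp only [nsmul_eq_mul, smul_eq_mul]
      rw [← mul_assoc, ← map_natCast (C (σ := ℕ) (R := ℂ)), ← C_mul]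
      simp
    · rw [if_neg (by omega), Pi.single_eq_of_ne (by omega)]
      simp

/-- `L(-1)` is the derivation of `M(1)` with `h(-n) ↦ n h(-n-1)`. -/
theorem translation_X_mul (k : ℕ) (v : Fock) :
    fockMode 0 0 conformalVector (X k * v) =
      X k * fockMode 0 0 conformalVector v + ((k : ℂ) + 1) • (X (k + 1) * v) := by
  have h := heisenbergMode_fockMode 0 conformalVector (-k - 1) 0 v
  rw [finsum_eq_single _ 1] at h
  · rw [heisenbergMode_conformalVector, if_pos rfl, fockMode_X_zero, heisenbergMode_neg_sub,
      heisenbergMode_neg_sub, show (-k - 1 + 0 - (1 : ℕ) : ℤ) = -(k + 1 : ℕ) - 1 by push_cast; ring,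
      heisenbergMode_neg_sub, intChoose, Ring.choose_one_right] at h
    rw [h, add_assoc, ← add_smul]
    push_cast
    rw [show (-(k : ℂ) - 1 + (k + 1)) = 0 by ring, zero_smul, add_zero]
  · intro t ht
    rw [heisenbergMode_conformalVector, if_neg ht]
    simp

/-- The `L(-1)`-derivative property `Y(L(-1)v,z) = (d/dz) Y(v,z)` on `M(1,μ)`. -/
theorem fockMode_translation (μ : ℂ) (v : Fock) (n : ℤ) (u : Fock) :
    fockMode μ n (fockMode 0 0 conformalVector v) u = (-n : ℂ) • fockMode μ (n - 1) v u := by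
  induction v using MvPolynomial.induction_on generalizing n u with
  | C c =>
    rw [translation_C, fockMode_C, map_zero, LinearMap.zero_apply]
    by_cases h : n = 0
    · simp [h]
    · rw [if_neg (by omega)]
      simp
  | add v w hv hw => simp only [map_add, LinearMap.add_apply, hv, hw, smul_add]
  | mul_X v k ih =>
    rw [mul_comm, translation_X_mul, map_add, map_smul, LinearMap.add_apply, LinearMap.smul_apply,
      fockMode_X_mul, fockMode_X_mul, fockMode_X_mul]
    obtain ⟨N, hN⟩ := currentIterate_support μ (fockMode_truncated μ v) (n - 1) u
    have hN1 : ∀ j : ℕ, N ≤ j → fockMode μ (n + j) v u = 0 := fun j hj => by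
      have := (hN (j + 1) (by omega)).1
      rwa [show n - 1 + ((j + 1 : ℕ) : ℤ) = n + j by push_cast; ring] at this
    have hσ : (-1 : ℂ) ^ (-(k + 1 : ℕ) - 1 : ℤ) = -(-1) ^ (-k - 1 : ℤ) := by
      rw [show (-(k + 1 : ℕ) - 1 : ℤ) = (-k - 1) - (1 : ℕ) by push_cast; ring,
        neg_one_zpow_sub_natCast]
      simp
    let E : ℕ → Fock := fun j =>
      heisenbergMode μ (-k - 1 - j) (fockMode μ (n - 1 + j) v u)
    let D : ℕ → Fock := fun j => ((-1 : ℂ) ^ (-k - 1 : ℤ)) •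
      fockMode μ (n - 1 + (-k - 1) - j) v (heisenbergMode μ j u)
    have hE : ∀ j, N ≤ j → E j = 0 := fun j hj => by simp [E, hN j hj]
    have hD : ∀ j, N ≤ j → D j = 0 := fun j hj => by simp [D, hN j hj]
    -- Both summands are combinations of the terms `E j` and `D j` that make up the modes of
    -- `h(-k-1)v`; in `e2` the creation part is shifted by one.
    have e1 : currentIterate μ (-k - 1)
        (fun m => fockMode μ m (fockMode 0 0 conformalVector v)) n u =
        ∑ᶠ j : ℕ, (altChoose (-k - 1) j * -(n + j)) • E j +
          ∑ᶠ j : ℕ, (altChoose (-k - 1) j * (n - k - 1 - j)) • D j := by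
      rw [currentIterate, ← finsum_add_distrib]
      · refine finsum_congr fun j => ?_
        rw [ih, ih, show n + (j : ℤ) - 1 = n - 1 + j by ring,
          show n + (-k - 1) - (j : ℤ) - 1 = n - 1 + (-k - 1) - j by ring, map_smul]
        simp only [E, D]
        push_cast
        module
      · exact hasFiniteSupport_of_ge N fun j hj => by rw [hE j hj, smul_zero]
      · exact hasFiniteSupport_of_ge N fun j hj => by rw [hD j hj, smul_zero]
    have e2 : ((k : ℂ) + 1) • currentIterate μ (-(k + 1 : ℕ) - 1) (fun m => fockMode μ m v) n u =
        ∑ᶠ j : ℕ, (altChoose (-k - 1) j * j) • E j +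
          ∑ᶠ j : ℕ, (altChoose (-k - 1) j * (k + 1 + j)) • D j := by
      rw [currentIterate, smul_finsum, finsum_shift (f := fun j : ℕ =>
        (altChoose (-k - 1) j * j) • E j) 1 (fun s hs => by
          rw [show s = 0 by omega]; simp), ← finsum_add_distrib]
      · refine finsum_congr fun j => ?_
        simp only [E, D]
        rw [hσ, show (-(k + 1 : ℕ) - 1 - j : ℤ) = -k - 1 - (j + 1 : ℕ) by push_cast; ring,
          show n - 1 + ((j + 1 : ℕ) : ℤ) = n + j by push_cast; ring,
          show n + (-(k + 1 : ℕ) - 1) - (j : ℤ) = n - 1 + (-k - 1) - j by push_cast; ring,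
          altChoose_neg_succ, altChoose_neg_succ, altChoose_neg_succ]
        have c1 : ((k : ℂ) + 1) * ((k + 1 + j).choose j : ℂ) =
            ((k + (j + 1)).choose (j + 1) : ℂ) * ((j + 1 : ℕ) : ℂ) := by
          have := Nat.choose_succ_right_eq (k + 1 + j) j
          rw [show k + 1 + j - j = k + 1 by omega] at this
          have := congrArg (Nat.cast (R := ℂ)) this
          rw [show k + 1 + j = k + (j + 1) by ring] at this ⊢
          push_cast at this ⊢
          linear_combination -this
        have c2 : ((k : ℂ) + 1) * ((k + 1 + j).choose j : ℂ) =
            ((k + j).choose j : ℂ) * (k + 1 + j) := by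
          have := Nat.choose_mul_succ_eq (k + j) j
          rw [show k + j + 1 - j = k + 1 by omega, show k + j + 1 = k + 1 + j by ring] at this
          have := congrArg (Nat.cast (R := ℂ)) this
          push_cast at this ⊢
          linear_combination -this
        rw [← c1, ← c2]
        module
      · exact hasFiniteSupport_of_ge N fun j hj => by rw [hE (j + 1) (by omega), smul_zero]
      · exact hasFiniteSupport_of_ge N fun j hj => by rw [hD j hj, smul_zero]
    have fE : ∀ c : ℕ → ℂ, Function.HasFiniteSupport fun j => c j • E j := fun c =>
      hasFiniteSupport_of_ge N fun j hj => by rw [hE j hj, smul_zero]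
    have fD : ∀ c : ℕ → ℂ, Function.HasFiniteSupport fun j => c j • D j := fun c =>
      hasFiniteSupport_of_ge N fun j hj => by rw [hD j hj, smul_zero]
    rw [e1, e2, add_add_add_comm, ← finsum_add_distrib (fE _) (fE _),
      ← finsum_add_distrib (fD _) (fD _), currentIterate, smul_finsum, ← finsum_add_distrib]
    · refine finsum_congr fun j => ?_
      simp only [E, D]
      module
    · exact hasFiniteSupport_of_ge N fun j hj => by simp [hE j hj]
    · exact hasFiniteSupport_of_ge N fun j hj => by simp [hD j hj]

end Translation

/-! ### Intertwining operators for `M(1)⁺` -/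

section IntertwiningOperators

variable {M₁ M₂ M₃ : Type*} [AddCommGroup M₁] [Module ℂ M₁]
  [AddCommGroup M₂] [Module ℂ M₂] [AddCommGroup M₃] [Module ℂ M₃]

/-- The formal series `∑_{n ∈ ℂ} vₙ z^(-n-1)` whose modes are those of a family indexed by the
integers, and zero at nonintegral `n`. -/
def extendModes (J : M₁ →ₗ[ℂ] ℤ → (M₂ →ₗ[ℂ] M₃)) : M₁ →ₗ[ℂ] ℂ → (M₂ →ₗ[ℂ] M₃) :=
  open Classical in
  LinearMap.pi fun n => if n = (⌊n.re⌋ : ℂ) then LinearMap.proj ⌊n.re⌋ ∘ₗ J else 0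

theorem extendModes_intCast (J : M₁ →ₗ[ℂ] ℤ → (M₂ →ₗ[ℂ] M₃)) (v : M₁) (n : ℤ) :
    extendModes J v n = J v n := by
  simp [extendModes]

theorem extendModes_of_forall_ne (J : M₁ →ₗ[ℂ] ℤ → (M₂ →ₗ[ℂ] M₃)) (v : M₁) {n : ℂ}
    (hn : ∀ k : ℤ, n ≠ k) : extendModes J v n = 0 := by
  simp [extendModes, hn]

/-- A family of maps `vₙ : M₂ → M₃`, `v ∈ M₁`, that embeddings of the `Mᵢ` into Fock spaces turn
into the modes of the vertex operators of `M(1)` on `M(1,μ)` is an intertwining operator for the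
subalgebra `M(1)⁺`. -/
theorem isIntertwining_extendModes (μ : ℂ) {Y₁ : orbifold 1 →ₗ[ℂ] VertexOperator ℂ M₁}
    {Y₂ : orbifold 1 →ₗ[ℂ] VertexOperator ℂ M₂} {Y₃ : orbifold 1 →ₗ[ℂ] VertexOperator ℂ M₃}
    (ι₁ : M₁ →ₗ[ℂ] Fock) (ι₂ : M₂ →ₗ[ℂ] Fock) (ι₃ : M₃ →ₗ[ℂ] Fock)
    (hι₃ : Function.Injective ι₃)
    (h₁ : ∀ (a : orbifold 1) (n : ℤ) (v : M₁),
      ι₁ (VertexOperator.ncoeff (Y₁ a) n v) = fockMode 0 n a (ι₁ v))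
    (h₂ : ∀ (a : orbifold 1) (n : ℤ) (u : M₂),
      ι₂ (VertexOperator.ncoeff (Y₂ a) n u) = fockMode μ n a (ι₂ u))
    (h₃ : ∀ (a : orbifold 1) (n : ℤ) (w : M₃),
      ι₃ (VertexOperator.ncoeff (Y₃ a) n w) = fockMode μ n a (ι₃ w))
    (J : M₁ →ₗ[ℂ] ℤ → (M₂ →ₗ[ℂ] M₃))
    (hJ : ∀ (v : M₁) (n : ℤ) (u : M₂), ι₃ (J v n u) = fockMode μ n (ι₁ v) (ι₂ u)) :
    IsIntertwining orbifoldOmega Y₁ Y₂ Y₃ (extendModes J) := by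
  refine ⟨fun v u n => ?_, fun a v u l m n => ?_, fun v n => ?_⟩
  · by_cases hn : ∃ k : ℤ, n = k
    · obtain ⟨q, rfl⟩ := hn
      obtain ⟨N, hN⟩ := fockMode_truncated μ (ι₁ v) (ι₂ u)
      refine ⟨N - q, fun k hk => hι₃ ?_⟩
      rw [← Int.cast_add, extendModes_intCast, hJ, hN _ (by omega), map_zero]
    · refine ⟨0, fun k _ => ?_⟩
      rw [extendModes_of_forall_ne, LinearMap.zero_apply]
      intro q hq
      exact hn ⟨q - k, by rw [Int.cast_sub, ← hq]; ring⟩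
  · by_cases hn : ∃ k : ℤ, n = k
    · obtain ⟨q, rfl⟩ := hn
      have key := borcherds_identity μ a (ι₁ v) l q m (ι₂ u)
      have mapf : ∀ f : ℕ → M₃, ι₃ (∑ᶠ i, f i) = ∑ᶠ i, ι₃ (f i) := fun f =>
        ι₃.toAddMonoidHom.map_finsum_of_injective hι₃ f
      apply hι₃
      rw [map_sub, mapf, mapf, mapf]
      refine Eq.trans (congrArg₂ (· - ·) ?_ ?_) (key.trans ?_)
      · refine finsum_congr fun i => ?_
        rw [← Int.cast_natCast (R := ℂ) i, ← Int.cast_add, extendModes_intCast, map_smul, h₃, hJ]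
        rfl
      · rw [oppSum, smul_finsum]
        refine finsum_congr fun i => ?_
        rw [← Int.cast_natCast (R := ℂ) i, ← Int.cast_add, ← Int.cast_sub, extendModes_intCast,
          map_smul, hJ, h₂, smul_smul, altChoose, intChoose, mul_assoc]
      · refine finsum_congr fun i => ?_
        rw [← Int.cast_natCast (R := ℂ) i, ← Int.cast_add, ← Int.cast_sub, extendModes_intCast,
          map_smul, hJ, h₁, intChoose]
    · have hz : ∀ (k : ℤ) (w : M₁), extendModes J w (n + k) = 0 := fun k w =>
        extendModes_of_forall_ne J w fun q hq =>
          hn ⟨q - k, by rw [Int.cast_sub, ← hq]; ring⟩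
      have hz1 : ∀ i : ℕ, extendModes J v (n + i) = 0 := fun i => by simpa using hz i v
      have hz2 : ∀ i : ℕ, extendModes J v (n + l - i) = 0 := fun i => by
        have := hz (l - i) v
        rwa [Int.cast_sub, Int.cast_natCast, ← add_sub_assoc] at this
      have hz3 : ∀ (i : ℕ) (w : M₁), extendModes J w (m + n - i) = 0 := fun i w => by
        have := hz (m - i) w
        rwa [Int.cast_sub, Int.cast_natCast, ← add_sub_assoc, add_comm n] at this
      simp [hz1, hz2, hz3]
  · by_cases hn : ∃ k : ℤ, n = k
    · obtain ⟨q, rfl⟩ := hn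
      refine LinearMap.ext fun u => hι₃ ?_
      rw [← Int.cast_one, ← Int.cast_sub, extendModes_intCast, extendModes_intCast, hJ, h₁,
        LinearMap.smul_apply, map_smul, hJ]
      exact fockMode_translation μ (ι₁ v) q (ι₂ u)
    · rw [extendModes_of_forall_ne J _ fun k hk => hn ⟨k, hk⟩,
        extendModes_of_forall_ne J _ fun k hk => hn ⟨k + 1, by
          rw [Int.cast_add, ← hk]; simp⟩, smul_zero]

theorem fusionRule_ne_zero {ω : orbifold 1} {Y₁ : orbifold 1 →ₗ[ℂ] VertexOperator ℂ M₁}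
    {Y₂ : orbifold 1 →ₗ[ℂ] VertexOperator ℂ M₂} {Y₃ : orbifold 1 →ₗ[ℂ] VertexOperator ℂ M₃}
    {I : M₁ →ₗ[ℂ] ℂ → (M₂ →ₗ[ℂ] M₃)} (hI : IsIntertwining ω Y₁ Y₂ Y₃ I) (h0 : I ≠ 0) :
    fusionRule ω Y₁ Y₂ Y₃ ≠ 0 := by
  have : Nontrivial (intertwiningOperators ω Y₁ Y₂ Y₃) :=
    ⟨⟨I, hI⟩, 0, fun h => h0 (congrArg Subtype.val h)⟩
  exact (rank_pos (R := ℂ) (M := intertwiningOperators ω Y₁ Y₂ Y₃)).ne'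

theorem one_mem_orbifold : (1 : Fock) ∈ orbifold 1 := by
  rw [mem_orbifold]
  simp

theorem X_zero_mem_orbifold : (X 0 : Fock) ∈ orbifold (-1) := by
  rw [mem_orbifold]
  simp [theta]

theorem orbifoldModule_apply (ε : ℤˣ) (a : orbifold 1) (n : ℤ) (u : orbifold ε) :
    (VertexOperator.ncoeff (orbifoldModule ε a) n u : Fock) = fockMode 0 n a u := by
  simp only [orbifoldModule, LinearMap.coe_mk, AddHom.coe_mk, restrictField, ncoeff_ofModes]
  rfl

theorem theta_theta (u : Fock) : theta (theta u) = u := by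
  have h : theta.comp theta = AlgHom.id ℂ Fock := by
    ext i
    simp [theta]
  exact congrArg (fun f : Fock →ₐ[ℂ] Fock => f u) h

/-- Each of `M(1)⁺`, `M(1)⁻` contains a nonzero vector whose mode of index `-1` is a multiplication
operator: the vacuum `𝟏` and `h(-1)𝟏`. -/
theorem exists_fockMode_neg_one_eq_mul (ε : ℤˣ) :
    ∃ v ∈ orbifold ε, v ≠ 0 ∧ ∀ (μ : ℂ) (u : Fock), fockMode μ (-1) v u = v * u := by
  rcases Int.units_eq_one_or ε with rfl | rfl
  · refine ⟨1, one_mem_orbifold, one_ne_zero, fun μ u => ?_⟩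
    rw [← C_1, fockMode_C, if_pos rfl, one_smul, C_1, one_mul]
  · refine ⟨X 0, X_zero_mem_orbifold, X_ne_zero 0, fun μ u => ?_⟩
    rw [fockMode_X_zero]
    exact heisenbergMode_neg μ 0 u

theorem fockMode_mem_orbifold {ε ε' ε'' : ℤˣ} (h : ε'' = ε * ε') {v u : Fock}
    (hv : v ∈ orbifold ε) (hu : u ∈ orbifold ε') (n : ℤ) : fockMode 0 n v u ∈ orbifold ε'' := by
  rw [mem_orbifold] at *
  rw [fockMode_eq, theta_fockY, hv, hu, neg_zero, h]
  simp [smul_smul, mul_comm]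

/-- The modes of the elements of `M(1)^ε` as maps `M(1)^ε' → M(1)^ε''`, where `ε'' = ε ε'`. -/
def orbifoldModes {ε ε' ε'' : ℤˣ} (h : ε'' = ε * ε') :
    orbifold ε →ₗ[ℂ] ℤ → (orbifold ε' →ₗ[ℂ] orbifold ε'') where
  toFun v n := (fockMode 0 n v).restrict fun _ hu => fockMode_mem_orbifold h v.2 hu n
  map_add' v w := by
    ext n u : 3
    simp
  map_smul' c v := by
    ext n u : 3
    simp

theorem fusionRule_orbifold_ne_zero {ε ε' ε'' : ℤˣ} (h : ε'' = ε * ε') :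
    fusionRule orbifoldOmega (orbifoldModule ε) (orbifoldModule ε') (orbifoldModule ε'') ≠ 0 := by
  refine fusionRule_ne_zero (isIntertwining_extendModes 0 (Y₁ := orbifoldModule ε)
    (Y₂ := orbifoldModule ε') (Y₃ := orbifoldModule ε'') (orbifold ε).subtype
    (orbifold ε').subtype (orbifold ε'').subtype Subtype.val_injective
    (orbifoldModule_apply ε) (orbifoldModule_apply ε') (orbifoldModule_apply ε'')
    (orbifoldModes h) fun v n u => rfl) fun h0 => ?_
  obtain ⟨v, hv, hv0, hmul⟩ := exists_fockMode_neg_one_eq_mul ε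
  obtain ⟨u, hu, hu0, -⟩ := exists_fockMode_neg_one_eq_mul ε'
  have h1 := extendModes_intCast (orbifoldModes h) ⟨v, hv⟩ (-1)
  rw [h0] at h1
  have h2 : (0 : Fock) = v * u := by
    rw [← hmul 0]
    exact congrArg (fun f : orbifold ε' →ₗ[ℂ] orbifold ε'' => (f ⟨u, hu⟩ : Fock)) h1
  exact mul_ne_zero hv0 hu0 h2.symm

/-- The modes on `M(1,μ)` of the elements of `M(1)^ε`, followed by a linear map `τ`. -/
def fockModes (ε : ℤˣ) (μ : ℂ) (τ : Fock →ₗ[ℂ] Fock) :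
    orbifold ε →ₗ[ℂ] ℤ → (Fock →ₗ[ℂ] Fock) :=
  LinearMap.pi fun n => (LinearMap.compRight ℂ τ) ∘ₗ fockMode μ n ∘ₗ (orbifold ε).subtype

/-- An involution `τ` of the Fock space that is an isomorphism of `M(1)⁺`-modules from `M(1,ν)` to
`M(1,μ)` turns the module action of `M(1)^ε` on `M(1,μ)` into an intertwining operator. -/
theorem fusionRule_fock_ne_zero (ε : ℤˣ) {μ ν : ℂ} (τ : Fock →ₗ[ℂ] Fock)
    (hτ : ∀ u, τ (τ u) = u)
    (h : ∀ (a : orbifold 1) (n : ℤ) (w : Fock), τ (fockMode ν n a w) = fockMode μ n a (τ w)) :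
    fusionRule orbifoldOmega (orbifoldModule ε) (fockModule μ) (fockModule ν) ≠ 0 := by
  refine fusionRule_ne_zero (isIntertwining_extendModes μ (Y₁ := orbifoldModule ε)
    (Y₂ := fockModule μ) (Y₃ := fockModule ν) (orbifold ε).subtype
    LinearMap.id τ (Function.LeftInverse.injective hτ)
    (orbifoldModule_apply ε) (fun a n u => rfl) h
    (fockModes ε μ τ) fun v n u => hτ _) fun h0 => ?_
  obtain ⟨v, hv, hv0, hmul⟩ := exists_fockMode_neg_one_eq_mul ε
  have h1 := extendModes_intCast (fockModes ε μ τ) ⟨v, hv⟩ (-1)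
  rw [h0] at h1
  have h2 : (0 : Fock) = τ (v * 1) := by
    rw [← hmul μ]
    exact congrArg (fun f : Fock →ₗ[ℂ] Fock => f 1) h1
  have h3 : (0 : Fock) = v := by
    rw [← hτ v, ← mul_one v, ← h2, map_zero]
  exact hv0 h3.symm

end IntertwiningOperators

end FreeBoson

end

theorem proposition6p2 :
    (∀ (ε : ℤˣ) (μ ν : ℂ), μ ^ 2 = ν ^ 2 →
      FreeBoson.fusionRule FreeBoson.orbifoldOmega (FreeBoson.orbifoldModule ε)
        (FreeBoson.fockModule μ) (FreeBoson.fockModule ν) ≠ 0) ∧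
    (∀ ε : ℤˣ,
      FreeBoson.fusionRule FreeBoson.orbifoldOmega (FreeBoson.orbifoldModule 1)
        (FreeBoson.orbifoldModule ε) (FreeBoson.orbifoldModule ε) ≠ 0) ∧
    (∀ ε : ℤˣ,
      FreeBoson.fusionRule FreeBoson.orbifoldOmega (FreeBoson.orbifoldModule (-1))
        (FreeBoson.orbifoldModule ε) (FreeBoson.orbifoldModule (-ε)) ≠ 0) := by
  refine ⟨fun ε μ ν h => ?_, fun ε => FreeBoson.fusionRule_orbifold_ne_zero (one_mul ε).symm,
    fun ε => FreeBoson.fusionRule_orbifold_ne_zero (neg_one_mul ε).symm⟩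
  rcases sq_eq_sq_iff_eq_or_eq_neg.1 h with rfl | rfl
  · exact FreeBoson.fusionRule_fock_ne_zero ε LinearMap.id (fun _ => rfl) fun _ _ _ => rfl
  · refine FreeBoson.fusionRule_fock_ne_zero ε FreeBoson.theta.toLinearMap FreeBoson.theta_theta
      fun a n w => ?_
    have ha := FreeBoson.mem_orbifold.1 a.2
    rw [Units.val_one, Int.cast_one, one_smul] at ha
    have := FreeBoson.theta_fockY ν a w n
    rwa [ha] at this
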